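/- Let $I\subseteq\mathbb R$ be an interval symmetric about $0$, let $f:I\to\mathbb R$ be a smooth, positive, even function, let $c>0$, and put $$F(s)=\int_0^s f(x)\,dx,\qquad \varphi(s)=\frac{F(s)}{f(s)} .$$ Let $Y=I\times S^1$, where $S^1=[0,2\pi]/_{0\sim 2\pi}$, and let $Y\times\mathbb R=I\times S^1\times\mathbb R$, with coordinates $(s,\theta,y)$, carry the metric $ds^2+c^2f(s)^2\,d\theta^2+dy^2$. Suppose that $\log F$ has its first inflection point at a value $s_0>0$: $(\log F)''<0$ on $(0,s_0)$, and there is $\delta>0$ with $(s_0,s_0+\delta)\subseteq I$ and $(\log F)''>0$ on $(s_0,s_0+\delta)$. Then there is a family $\{S_{s_1}\}_{0<s_1<s_0}$ of soap bubbles in $Y\times\mathbb R$ with the following properties. * Each $S_{s_1}$ is a smoothly embedded torus contained in $(-s_0,s_0)\times S^1\times\mathbb R$, and is the boundary of a relatively compact smooth domain $\Omega_{s_1}\subset Y\times\mathbb R$. * Each $S_{s_1}$ has constant mean curvature $H=1/\varphi(s_1)$ with respect to the unit normal pointing out of $\Omega_{s_1}$. Here the mean curvature is the trace of the second fundamental form,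 so that the unit sphere of $\mathbb R^d$ has mean curvature $d-1$ with respect to its outer normal. * The enclosed volume, i.e. the Riemannian volume of $\Omega_{s_1}$, is finite for every $s_1\in(0,s_0)$ and tends to $+\infty$ as $s_1\to s_0$ from below. -/

import Mathlib

open Set Filter Topology
open scoped Manifold ContDiff ENNReal

noncomputable section

/-! ### Classical Riemannian geometry of hypersurfaces in coordinates -/

/-- Points and tangent vectors in an `n`-dimensional coordinate space. -/
abbrev Coord (n : ℕ) : Type := Fin n → ℝ

/-- The partial derivative `∂ᵢ F` at the point `p`. -/
def partialD {n : ℕ} (i : Fin n) (F : Coord n → ℝ) (p : Coord n) : ℝ :=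
  fderiv ℝ F p (Pi.single i 1)

/-- The inner product of `v` and `w` at the point `p`, for the Riemannian metric
`∑ g_{ij} dxⁱ dxʲ`. -/
def gInner {n : ℕ} (g : Coord n → Matrix (Fin n) (Fin n) ℝ) (p v w : Coord n) : ℝ :=
  ∑ i, ∑ j, g p i j * v i * w j

/-- The Christoffel symbol `Γᵏᵢⱼ` of the Levi-Civita connection of `g`. -/
def christoffel {n : ℕ} (g : Coord n → Matrix (Fin n) (Fin n) ℝ) (p : Coord n)
    (k i j : Fin n) : ℝ :=
  (1 / 2) * ∑ l, (g p)⁻¹ k l *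
    (partialD i (fun q => g q j l) p + partialD j (fun q => g q i l) p
      - partialD l (fun q => g q i j) p)

/-- The coordinate tangent vector `∂ₐX` of a parametrized `m`-dimensional surface `X`. -/
def tangentVec {m n : ℕ} (X : Coord m → Coord n) (a : Fin m) (u : Coord m) : Coord n :=
  fun k => partialD a (fun w => X w k) u

/-- The covariant derivative `∇_{∂ₐX} N` of a vector field `N` along `X`, for the Levi-Civita
connection of `g`. -/
def covDerivAlong {m n : ℕ} (g : Coord n → Matrix (Fin n) (Fin n) ℝ)
    (X N : Coord m → Coord n) (a : Fin m) (u : Coord m) : Coord n :=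
  fun k => partialD a (fun w => N w k) u
    + ∑ i, ∑ j, christoffel g (X u) k i j * tangentVec X a u i * N u j

/-- The first fundamental form of `X`. -/
def firstForm {m n : ℕ} (g : Coord n → Matrix (Fin n) (Fin n) ℝ)
    (X : Coord m → Coord n) (u : Coord m) : Matrix (Fin m) (Fin m) ℝ :=
  Matrix.of fun a b => gInner g (X u) (tangentVec X a u) (tangentVec X b u)

/-- The second fundamental form `⟨∇_{∂ₐX} N, ∂_bX⟩` of `X` with respect to the unit normal `N`.
With this sign the spheres of Euclidean space are positive for the outer normal. -/
def secondForm {m n : ℕ} (g : Coord n → Matrix (Fin n) (Fin n) ℝ)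
    (X N : Coord m → Coord n) (u : Coord m) : Matrix (Fin m) (Fin m) ℝ :=
  Matrix.of fun a b => gInner g (X u) (covDerivAlong g X N a u) (tangentVec X b u)

/-- The (unnormalized) mean curvature of `X` with respect to the unit normal `N`: the trace of the
second fundamental form with respect to the first. The unit sphere of `ℝᵈ` has mean curvature
`d - 1` with respect to the outer normal. -/
def meanCurv {m n : ℕ} (g : Coord n → Matrix (Fin n) (Fin n) ℝ)
    (X N : Coord m → Coord n) (u : Coord m) : ℝ :=
  ((firstForm g X u)⁻¹ * secondForm g X N u).trace

/-- `N` is a smooth unit normal field along the parametrized surface `X : U → ℝⁿ`. -/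
def IsUnitNormalAlong {m n : ℕ} (g : Coord n → Matrix (Fin n) (Fin n) ℝ)
    (X N : Coord m → Coord n) (U : Set (Coord m)) : Prop :=
  ContDiffOn ℝ ∞ N U ∧
    ∀ u ∈ U, gInner g (X u) (N u) (N u) = 1 ∧
      ∀ a, gInner g (X u) (N u) (tangentVec X a u) = 0

/-- `X : U → T ∩ V` is a local parametrization (in the sense of embedded surfaces) of the
`m`-dimensional surface `T` in `n`-dimensional coordinate space. -/
structure IsLocalParam {m n : ℕ} (T : Set (Coord n)) (U : Set (Coord m)) (V : Set (Coord n))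
    (X : Coord m → Coord n) : Prop where
  isOpen_source : IsOpen U
  isOpen_target : IsOpen V
  smooth : ContDiffOn ℝ ∞ X U
  regular : ∀ u ∈ U, Function.Injective (fderiv ℝ X u)
  image_eq : X '' U = T ∩ V
  isEmbedding : IsEmbedding (U.domRestrict X)

/-! ### The manifold `Y × ℝ = I × S¹ × ℝ` -/

/-- The manifold `ℝ × S¹ × ℝ` of points `(s, θ, y)`. The manifold `Y × ℝ = I × S¹ × ℝ` is its part
where `s ∈ I`. -/
abbrev Tube : Type := ℝ × Circle × ℝ

/-- The subset `I × S¹ × ℝ`. -/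
def tubeOver (I : Set ℝ) : Set Tube := {q | q.1 ∈ I}

/-- The universal covering of `ℝ × S¹ × ℝ` by its coordinate space `(s, θ, y) ∈ ℝ³`: local
coordinates on `ℝ × S¹ × ℝ` are the local inverses of this map. -/
def cover (p : Coord 3) : Tube := (p 0, Circle.exp (p 1), p 2)

/-- The metric `ds² + c² f(s)² dθ² + dy²` in the coordinates `(s, θ, y)`. -/
def tubeMetric (c : ℝ) (f : ℝ → ℝ) (p : Coord 3) : Matrix (Fin 3) (Fin 3) ℝ :=
  Matrix.diagonal ![1, c ^ 2 * f (p 0) ^ 2, 1]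

/-- The Riemannian volume of a subset of `ℝ × S¹ × ℝ`, for a metric given in the coordinates
`(s, θ, y)`: the integral of `√(det g)` over the points with `0 ≤ θ < 2π`. -/
def riemVolume (g : Coord 3 → Matrix (Fin 3) (Fin 3) ℝ) (A : Set Tube) : ℝ≥0∞ :=
  ∫⁻ p in cover ⁻¹' A ∩ {p | p 1 ∈ Ico 0 (2 * Real.pi)}, ENNReal.ofReal √((g p).det)

/-- The vector field `N` along `X` points out of the region `Ω`. -/
def PointsOutOf (Ω : Set Tube) (X N : Coord 2 → Coord 3) (U : Set (Coord 2)) : Prop :=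
  ∀ u ∈ U, ∀ᶠ t : ℝ in 𝓝[>] 0,
    cover (X u - t • N u) ∈ Ω ∧ cover (X u + t • N u) ∉ closure Ω

/-- The smooth hypersurface `S = ∂Ω` has constant mean curvature `H` with respect to the unit
normal that points out of `Ω`: near every point there is a local parametrization of `S`
with a smooth outward unit normal for which the mean curvature is identically `H`. (The existence
of the parametrizations also says that `S` is a smooth embedded surface.) -/
def HasConstMeanCurv (g : Coord 3 → Matrix (Fin 3) (Fin 3) ℝ) (S Ω : Set Tube) (H : ℝ) : Prop :=
  ∀ p ∈ cover ⁻¹' S, ∃ (U : Set (Coord 2)) (V : Set (Coord 3)) (X N : Coord 2 → Coord 3),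
    p ∈ V ∧ IsLocalParam (cover ⁻¹' S) U V X ∧ IsUnitNormalAlong g X N U ∧
      PointsOutOf Ω X N U ∧ ∀ u ∈ U, meanCurv g X N u = H

/-- `S` is a soap bubble in `I × S¹ × ℝ`, of mean curvature `H` and enclosing `Ω`:
`Ω` is a relatively compact domain in `I × S¹ × ℝ`, lying on one side of its boundary, and
this boundary is `S`, a smooth embedded hypersurface of constant mean curvature `H`. -/
structure IsSoapBubble (I : Set ℝ) (g : Coord 3 → Matrix (Fin 3) (Fin 3) ℝ)
    (S Ω : Set Tube) (H : ℝ) : Prop where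
  isOpen : IsOpen Ω
  isConnected : IsConnected Ω
  isCompact_closure : IsCompact (closure Ω)
  closure_subset : closure Ω ⊆ tubeOver I
  one_sided : interior (closure Ω) = Ω
  frontier_eq : frontier Ω = S
  constMeanCurv : HasConstMeanCurv g S Ω H

/-- `S` is an embedded torus: the image of a smooth embedding `S¹ × S¹ → ℝ × S¹ × ℝ`, that is, of
a smooth map with injective differentials which is a topological embedding. -/
def IsEmbeddedTorus (S : Set Tube) : Prop :=
  ∃ Φ : Circle × Circle → Tube,
    ContMDiff ((𝓡 1).prod (𝓡 1)) (𝓘(ℝ, ℝ).prod ((𝓡 1).prod 𝓘(ℝ, ℝ))) ∞ Φ ∧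
    (∀ z, Function.Injective
      (mfderiv ((𝓡 1).prod (𝓡 1)) (𝓘(ℝ, ℝ).prod ((𝓡 1).prod 𝓘(ℝ, ℝ))) Φ z)) ∧
    IsEmbedding Φ ∧ range Φ = S

/-! ### The auxiliary functions -/

/-- `F(s) = ∫₀ˢ f`. -/
def primF (f : ℝ → ℝ) (s : ℝ) : ℝ := ∫ x in (0 : ℝ)..s, f x

/-- `φ = F / f`. -/
def phiFun (f : ℝ → ℝ) (s : ℝ) : ℝ := primF f s / f s

end

/-! Each bubble is obtained by rotating a closed curve in the `(s, y)`-plane around the circle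
factor. If the curve has direction `(cos α, -sin α)` and speed `v`, the surface has mean curvature
`1/v + (f'/f) sin α` for the normal `(sin α, 0, cos α)` (`meanCurv_revSurface`). Constancy of this
with value `H` integrates to `f sin α = H F`, that is, `φ(s) = φ(r) sin α` with `H = 1/φ(r)`. This
first integral is taken as the definition of the curve, with the angle `α` as parameter: `s =
φ⁻¹(φ(r) sin α)`, `v = φ(r)/φ'(s)`, and `y` by integrating `-v sin α`. The identity `φ' = 1 - φ
f'/f` then gives the mean curvature at once (`IsWarping.hasConstMeanCurv`).

The inverse of `φ` is available because `(log F)'' = -φ'/φ²`: before the inflection point `φ` has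
positive derivative. Since `φ` is odd, the curve is symmetric in both axes, hence closes up after
`2π`. It is simple because `s` determines `sin α` and the sign of `y` is that of `cos α`
(`IsOddIncreasing.exp_eq_of_prof_eq`). It therefore bounds a region `|y| < u(s)` over `(-r, r)`,
where `u' = -φ/√(φ(r)² - φ²)`.

At the inflection point `φ'(s₀) = 0`, so `φ(s₀) - φ(x)` is at most a multiple of `(s₀ - x)²`
(`IsWarping.exists_quadratic_bound`). Hence `-u'(x)` is at least a multiple of `1/(s₀ - x)`, and
`u(x)` is at least a multiple of `log ((s₀ - x)/(s₀ - r))` (`IsWarping.exists_log_le_height`). This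
diverges as `r → s₀`, uniformly over a fixed interval of `x`, which forces the volume to infinity.
-/

/-! ### The warping function, its primitive and the quotient `φ`. -/

/-- `f` is smooth, positive and even on the interval `(-b, b)`. -/
structure IsWarping (f : ℝ → ℝ) (b : ℝ) : Prop where
  pos_radius : 0 < b
  smooth : ContDiffOn ℝ ∞ f (Ioo (-b) b)
  pos : ∀ s ∈ Ioo (-b) b, 0 < f s
  even : ∀ s ∈ Ioo (-b) b, f (-s) = f s

lemma phiFun_zero {f : ℝ → ℝ} : phiFun f 0 = 0 := by simp [phiFun, primF]

namespace IsWarping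

variable {f : ℝ → ℝ} {b : ℝ}

lemma zero_mem (h : IsWarping f b) : (0 : ℝ) ∈ Ioo (-b) b := ⟨neg_lt_zero.2 h.pos_radius, h.pos_radius⟩

lemma differentiableAt (h : IsWarping f b) {s : ℝ} (hs : s ∈ Ioo (-b) b) : DifferentiableAt ℝ f s :=
  (h.smooth.contDiffAt (isOpen_Ioo.mem_nhds hs)).differentiableAt (by simp)

lemma uIcc_subset (h : IsWarping f b) {s : ℝ} (hs : s ∈ Ioo (-b) b) : uIcc 0 s ⊆ Ioo (-b) b :=
  ordConnected_Ioo.uIcc_subset h.zero_mem hs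

lemma hasDerivAt_primF (h : IsWarping f b) {s : ℝ} (hs : s ∈ Ioo (-b) b) : HasDerivAt (primF f) (f s) s := by
  have hc := h.smooth.continuousOn
  refine intervalIntegral.integral_hasDerivAt_right
    ((hc.mono (h.uIcc_subset hs)).intervalIntegrable)
    (hc.stronglyMeasurableAtFilter isOpen_Ioo s hs) (h.differentiableAt hs).continuousAt

lemma contDiffOn_primF (h : IsWarping f b) : ContDiffOn ℝ ∞ (primF f) (Ioo (-b) b) := by
  rw [contDiffOn_infty_iff_deriv_of_isOpen isOpen_Ioo]
  refine ⟨fun s hs => (h.hasDerivAt_primF hs).differentiableAt.differentiableWithinAt,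
    h.smooth.congr fun s hs => (h.hasDerivAt_primF hs).deriv⟩

lemma primF_neg (h : IsWarping f b) {s : ℝ} (hs : s ∈ Ioo (-b) b) : primF f (-s) = -primF f s := by
  unfold primF
  have h1 : ∫ x in (0 : ℝ)..s, f x = ∫ x in (0 : ℝ)..s, f (-x) :=
    intervalIntegral.integral_congr fun x hx => (h.even x (h.uIcc_subset hs hx)).symm
  rw [h1, intervalIntegral.integral_comp_neg, neg_zero, ← intervalIntegral.integral_symm]

lemma primF_pos (h : IsWarping f b) {s : ℝ} (hs : s ∈ Ioo 0 b) : 0 < primF f s := by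
  have hs' : s ∈ Ioo (-b) b := ⟨by linarith [hs.1, hs.2], hs.2⟩
  refine intervalIntegral.intervalIntegral_pos_of_pos_on
    ((h.smooth.continuousOn.mono (h.uIcc_subset hs')).intervalIntegrable) (fun x hx => ?_) hs.1
  exact h.pos x ⟨by linarith [hx.1, h.pos_radius], hx.2.trans hs.2⟩

lemma phiFun_neg (h : IsWarping f b) {s : ℝ} (hs : s ∈ Ioo (-b) b) : phiFun f (-s) = -phiFun f s := by
  rw [phiFun, phiFun, h.primF_neg hs, h.even s hs, neg_div]

lemma phiFun_pos (h : IsWarping f b) {s : ℝ} (hs : s ∈ Ioo 0 b) : 0 < phiFun f s :=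
  div_pos (h.primF_pos hs) (h.pos s ⟨by linarith [hs.1, hs.2], hs.2⟩)

lemma contDiffOn_phiFun (h : IsWarping f b) : ContDiffOn ℝ ∞ (phiFun f) (Ioo (-b) b) :=
  h.contDiffOn_primF.div h.smooth fun s hs => (h.pos s hs).ne'

/-- The quotient rule in the form `φ' + φ f'/f = 1`; this is the identity behind the constancy of
the mean curvature. -/
lemma hasDerivAt_phiFun (h : IsWarping f b) {s : ℝ} (hs : s ∈ Ioo (-b) b) :
    HasDerivAt (phiFun f) (1 - phiFun f s * (deriv f s / f s)) s := by
  have hf := (h.pos s hs).ne'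
  refine ((h.hasDerivAt_primF hs).div (h.differentiableAt hs).hasDerivAt hf).congr_deriv ?_
  rw [phiFun]
  field_simp

lemma continuousOn_deriv_phiFun (h : IsWarping f b) : ContinuousOn (deriv (phiFun f)) (Ioo (-b) b) :=
  ((contDiffOn_infty_iff_deriv_of_isOpen isOpen_Ioo).1 h.contDiffOn_phiFun).2.continuousOn

/-- Since `(log F)' = f/F = 1/φ`, convexity of `log F` is governed by the sign of `φ'`. -/
lemma deriv_deriv_log_primF (h : IsWarping f b) {s : ℝ} (hs : s ∈ Ioo 0 b) :
    deriv (deriv fun x => Real.log (primF f x)) s = -deriv (phiFun f) s / phiFun f s ^ 2 := by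
  have key : (deriv fun x => Real.log (primF f x)) =ᶠ[𝓝 s] fun x => (phiFun f x)⁻¹ := by
    filter_upwards [isOpen_Ioo.mem_nhds hs] with x hx
    have hx' : x ∈ Ioo (-b) b := ⟨by linarith [hx.1, hx.2], hx.2⟩
    rw [((h.hasDerivAt_primF hx').log (h.primF_pos hx).ne').deriv, phiFun, inv_div]
  rw [key.deriv_eq]
  have hs' : s ∈ Ioo (-b) b := ⟨by linarith [hs.1, hs.2], hs.2⟩
  exact ((h.hasDerivAt_phiFun hs').differentiableAt.hasDerivAt.inv (h.phiFun_pos hs).ne').deriv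

end IsWarping

/-! ### Monotonicity of `φ` and its behaviour at the inflection point. -/

/-- `φ` is smooth and odd on `(-a, a)`, with positive derivative. -/
structure IsOddIncreasing (φ : ℝ → ℝ) (a : ℝ) : Prop where
  smooth : ContDiffOn ℝ ∞ φ (Ioo (-a) a)
  odd : ∀ s ∈ Ioo (-a) a, φ (-s) = -φ s
  deriv_pos : ∀ s ∈ Ioo (-a) a, 0 < deriv φ s

/-- The derivative of an odd function on `(-a, a)` is even. -/
lemma deriv_neg_of_odd {φ : ℝ → ℝ} {a : ℝ} (hodd : ∀ s ∈ Ioo (-a) a, φ (-s) = -φ s)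
    {s : ℝ} (hs : s ∈ Ioo (-a) a) : deriv φ (-s) = deriv φ s := by
  have key : φ =ᶠ[𝓝 s] fun x => -φ (-x) := by
    filter_upwards [isOpen_Ioo.mem_nhds hs] with x hx
    rw [hodd x hx, neg_neg]
  rw [key.deriv_eq, deriv.fun_neg, deriv_comp_neg, neg_neg]

namespace IsWarping

variable {f : ℝ → ℝ} {b s₀ : ℝ}

lemma deriv_phiFun_pos (h : IsWarping f b)
    (hs₀b : s₀ < b)
    (hneg : ∀ s ∈ Ioo 0 s₀, deriv (deriv fun x => Real.log (primF f x)) s < 0) :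
    ∀ s ∈ Ioo (-s₀) s₀, 0 < deriv (phiFun f) s := by
  have hp : ∀ s ∈ Ioo 0 s₀, 0 < deriv (phiFun f) s := by
    intro s hs
    have hs' : s ∈ Ioo 0 b := ⟨hs.1, hs.2.trans hs₀b⟩
    have := hneg s hs
    rw [h.deriv_deriv_log_primF hs', neg_div, neg_lt_zero] at this
    exact (div_pos_iff_of_pos_right (pow_pos (h.phiFun_pos hs') 2)).1 this
  intro s hs
  rcases lt_trichotomy s 0 with h0 | rfl | h0
  · rw [← deriv_neg_of_odd (a := b) (fun x hx => h.phiFun_neg hx)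
      ⟨by linarith [hs.1], by linarith [h.pos_radius]⟩]
    exact hp _ ⟨by linarith, by linarith [hs.1]⟩
  -- At the origin `log F` says nothing, but `φ(0) = 0` gives `φ'(0) = 1`.
  · rw [(h.hasDerivAt_phiFun h.zero_mem).deriv, phiFun_zero]
    norm_num
  · exact hp s ⟨h0, hs.2⟩

lemma isOddIncreasing (h : IsWarping f b)
    (hs₀b : s₀ < b)
    (hneg : ∀ s ∈ Ioo 0 s₀, deriv (deriv fun x => Real.log (primF f x)) s < 0) :
    IsOddIncreasing (phiFun f) s₀ where
  smooth := h.contDiffOn_phiFun.mono (Ioo_subset_Ioo (by linarith) hs₀b.le)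
  odd s hs := h.phiFun_neg ⟨by linarith [hs.1], by linarith [hs.2]⟩
  deriv_pos := h.deriv_phiFun_pos hs₀b hneg

/-- At an inflection point of `log F` the derivative of `φ` vanishes. -/
lemma deriv_phiFun_eq_zero (h : IsWarping f b) (hs₀ : 0 < s₀) (hs₀b : s₀ < b)
    (hneg : ∀ s ∈ Ioo 0 s₀, deriv (deriv fun x => Real.log (primF f x)) s < 0)
    (hpos : ∀ s ∈ Ioo s₀ b, 0 < deriv (deriv fun x => Real.log (primF f x)) s) :
    deriv (phiFun f) s₀ = 0 := by
  have hc : ContinuousAt (deriv (phiFun f)) s₀ :=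
    h.continuousOn_deriv_phiFun.continuousAt (Ioo_mem_nhds (by linarith) hs₀b)
  apply le_antisymm
  -- Convexity of `log F` just after `s₀` gives `φ' ≤ 0` in the limit from the right; monotonicity
  -- before `s₀` gives the other inequality.
  · refine le_of_tendsto (hc.tendsto.mono_left (nhdsWithin_le_nhds (s := Ioi s₀))) ?_
    filter_upwards [Ioo_mem_nhdsGT hs₀b] with s hs
    have hs' : s ∈ Ioo 0 b := ⟨hs₀.trans hs.1, hs.2⟩
    have := hpos s hs
    rw [h.deriv_deriv_log_primF hs', neg_div, neg_pos] at this
    by_contra! hcon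
    exact absurd this (not_lt.2 (div_nonneg hcon.le (sq_nonneg _)))
  · refine ge_of_tendsto (hc.tendsto.mono_left (nhdsWithin_le_nhds (s := Iio s₀))) ?_
    filter_upwards [Ioo_mem_nhdsLT hs₀] with s hs
    exact (h.deriv_phiFun_pos hs₀b hneg s ⟨by linarith [hs.1], hs.2⟩).le

/-- Near a critical point `s₀` the function `φ` is at quadratic distance from `φ(s₀)`. -/
lemma exists_quadratic_bound (h : IsWarping f b) (hs₀ : 0 < s₀) (hs₀b : s₀ < b)
    (hcrit : deriv (phiFun f) s₀ = 0) :
    ∃ K > 0, ∀ x ∈ Ioo 0 s₀, phiFun f s₀ - phiFun f x ≤ K * (s₀ - x) ^ 2 := by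
  have hsub : Icc 0 s₀ ⊆ Ioo (-b) b := fun x hx => ⟨by linarith [hx.1], by linarith [hx.2]⟩
  have hsm := ((contDiffOn_infty_iff_deriv_of_isOpen isOpen_Ioo).1 h.contDiffOn_phiFun).2
  have hsm2 := ((contDiffOn_infty_iff_deriv_of_isOpen isOpen_Ioo).1 hsm)
  -- `K` bounds `|φ''|` on `[0, s₀]`. The mean value inequality is applied twice: to `φ'`, which
  -- vanishes at `s₀`, then to `φ`.
  obtain ⟨K, hK⟩ := isCompact_Icc.exists_bound_of_continuousOn (hsm2.2.continuousOn.mono hsub)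
  have hbound : ∀ x ∈ Icc 0 s₀, |deriv (phiFun f) x| ≤ K * (s₀ - x) := by
    intro x hx
    have := (convex_Icc 0 s₀).norm_image_sub_le_of_norm_deriv_le (f := deriv (phiFun f))
      (fun y hy => (hsm2.1.differentiableAt (isOpen_Ioo.mem_nhds (hsub hy))))
      hK hx (right_mem_Icc.2 hs₀.le)
    rw [hcrit, zero_sub, norm_neg, Real.norm_eq_abs, Real.norm_eq_abs,
      abs_of_nonneg (by linarith [hx.2] : 0 ≤ s₀ - x)] at this
    exact this
  have hK0 : 0 ≤ K := (norm_nonneg _).trans (hK 0 (left_mem_Icc.2 hs₀.le))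
  refine ⟨K + 1, by linarith, fun x hx => ?_⟩
  have hdx : 0 ≤ s₀ - x := by linarith [hx.2]
  have := (convex_Icc x s₀).norm_image_sub_le_of_norm_deriv_le (f := phiFun f)
      (C := K * (s₀ - x))
      (fun y hy => (h.hasDerivAt_phiFun (hsub ⟨hx.1.le.trans hy.1, hy.2⟩)).differentiableAt)
      (fun y hy => (hbound y ⟨hx.1.le.trans hy.1, hy.2⟩).trans
        (mul_le_mul_of_nonneg_left (by linarith [hy.1]) hK0))
      (left_mem_Icc.2 hx.2.le) (right_mem_Icc.2 hx.2.le)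
  rw [Real.norm_eq_abs, Real.norm_eq_abs, abs_of_nonneg hdx] at this
  nlinarith [le_abs_self (phiFun f s₀ - phiFun f x), sq_nonneg (s₀ - x)]

end IsWarping

/-! ### The profile curve, parametrized by its angle. -/

/-- The inverse function of the restriction of `φ` to `(-a, a)`. -/
noncomputable def profInv (φ : ℝ → ℝ) (a : ℝ) : ℝ → ℝ := Function.invFunOn φ (Ioo (-a) a)

/-- The `s`-coordinate of the profile curve at the angle `α`. -/
noncomputable def profS (φ : ℝ → ℝ) (a r α : ℝ) : ℝ := profInv φ a (φ r * Real.sin α)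

/-- The speed of the profile curve at the angle `α`. -/
noncomputable def profV (φ : ℝ → ℝ) (a r α : ℝ) : ℝ := φ r / deriv φ (profS φ a r α)

/-- The `y`-coordinate of the profile curve at the angle `α`. -/
noncomputable def profY (φ : ℝ → ℝ) (a r α : ℝ) : ℝ :=
  ∫ t in α..(Real.pi / 2), profV φ a r t * Real.sin t

/-- The upper half of the profile curve as a graph over `[-r, r]`, extended by zero. -/
noncomputable def height (φ : ℝ → ℝ) (a r x : ℝ) : ℝ :=
  profY φ a r (Real.arcsin (φ (max (-r) (min r x)) / φ r))

namespace IsOddIncreasing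

variable {φ : ℝ → ℝ} {a r : ℝ}

lemma strictMonoOn (h : IsOddIncreasing φ a) : StrictMonoOn φ (Ioo (-a) a) :=
  strictMonoOn_of_deriv_pos (convex_Ioo _ _) h.smooth.continuousOn fun s hs =>
    h.deriv_pos s (interior_subset hs)

lemma profInv_apply (h : IsOddIncreasing φ a) {s : ℝ} (hs : s ∈ Ioo (-a) a) :
    profInv φ a (φ s) = s :=
  h.strictMonoOn.injOn.leftInvOn_invFunOn hs

lemma hasDerivAt (h : IsOddIncreasing φ a) {s : ℝ} (hs : s ∈ Ioo (-a) a) :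
    HasDerivAt φ (deriv φ s) s :=
  ((h.smooth.contDiffAt (isOpen_Ioo.mem_nhds hs)).differentiableAt (by simp)).hasDerivAt

/-- The local inverse from the inverse function theorem agrees with `profInv` near `φ s`, by
injectivity of `φ`. -/
lemma contDiffAt_profInv (h : IsOddIncreasing φ a) {s : ℝ} (hs : s ∈ Ioo (-a) a) :
    ContDiffAt ℝ ∞ (profInv φ a) (φ s) := by
  have hc := h.smooth.contDiffAt (isOpen_Ioo.mem_nhds hs)
  have hd := h.hasDerivAt hs
  have hne := (h.deriv_pos s hs).ne'
  have hf' : HasFDerivAt φ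
      ((ContinuousLinearEquiv.unitsEquivAut ℝ (Units.mk0 _ hne) : ℝ ≃L[ℝ] ℝ) : ℝ →L[ℝ] ℝ) s := by
    refine hd.hasFDerivAt.congr_fderiv ?_
    ext
    simp
  have hinv := hc.to_localInverse hf' (by simp)
  refine hinv.congr_of_eventuallyEq ?_
  have hstrict := hc.hasStrictFDerivAt' hf' (by simp)
  -- Continuity keeps the local inverse inside `(-a, a)`, the only place where `profInv` is known to
  -- undo `φ`.
  have hcont : Tendsto (hc.localInverse hf' (by simp)) (𝓝 (φ s)) (𝓝 s) := by
    have := hinv.continuousAt.tendsto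
    rwa [show hc.localInverse hf' (by simp) (φ s) = s from hstrict.localInverse_apply_image] at this
  filter_upwards [hstrict.eventually_right_inverse, hcont (isOpen_Ioo.mem_nhds hs)] with z hz hz'
  have hz2 : φ (hc.localInverse hf' (by simp) z) = z := hz
  conv_lhs => rw [← hz2]
  exact h.profInv_apply hz'

lemma map_zero (h : IsOddIncreasing φ a) (hr : r ∈ Ioo 0 a) : φ 0 = 0 := by
  have := h.odd 0 ⟨by linarith [hr.1, hr.2], by linarith [hr.1, hr.2]⟩
  rw [neg_zero] at this
  linarith

lemma Icc_subset (hr : r ∈ Ioo 0 a) : Icc (-r) r ⊆ Ioo (-a) a := fun _ hx =>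
  ⟨by linarith [hx.1, hr.2], by linarith [hx.2, hr.2]⟩

lemma map_pos (h : IsOddIncreasing φ a) (hr : r ∈ Ioo 0 a) : 0 < φ r := by
  rw [← h.map_zero hr]
  exact h.strictMonoOn ⟨by linarith [hr.1, hr.2], by linarith [hr.1, hr.2]⟩
    ⟨by linarith [hr.1, hr.2], hr.2⟩ hr.1

lemma exists_profS (h : IsOddIncreasing φ a) (hr : r ∈ Ioo 0 a) (α : ℝ) :
    ∃ s ∈ Icc (-r) r, φ s = φ r * Real.sin α := by
  have hpos := h.map_pos hr
  have hivt := intermediate_value_Icc (by linarith [hr.1] : -r ≤ r)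
    (h.smooth.continuousOn.mono (Icc_subset hr))
  rw [h.odd r (Icc_subset hr (right_mem_Icc.2 (by linarith [hr.1])))] at hivt
  exact hivt ⟨by nlinarith [Real.neg_one_le_sin α], by nlinarith [Real.sin_le_one α]⟩

lemma profS_mem (h : IsOddIncreasing φ a) (hr : r ∈ Ioo 0 a) (α : ℝ) :
    profS φ a r α ∈ Icc (-r) r := by
  obtain ⟨s, hs, hsα⟩ := h.exists_profS hr α
  rw [profS, ← hsα, h.profInv_apply (Icc_subset hr hs)]
  exact hs

lemma map_profS (h : IsOddIncreasing φ a) (hr : r ∈ Ioo 0 a) (α : ℝ) :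
    φ (profS φ a r α) = φ r * Real.sin α := by
  obtain ⟨s, hs, hsα⟩ := h.exists_profS hr α
  rw [profS, ← hsα, h.profInv_apply (Icc_subset hr hs)]

lemma contDiff_profS (h : IsOddIncreasing φ a) (hr : r ∈ Ioo 0 a) :
    ContDiff ℝ ∞ (profS φ a r) := by
  rw [contDiff_iff_contDiffAt]
  intro α
  have h1 := h.contDiffAt_profInv (Icc_subset hr (h.profS_mem hr α))
  rw [h.map_profS hr] at h1
  exact h1.comp α (contDiff_const.mul Real.contDiff_sin).contDiffAt

lemma contDiff_profV (h : IsOddIncreasing φ a) (hr : r ∈ Ioo 0 a) :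
    ContDiff ℝ ∞ (profV φ a r) := by
  have hd := ((contDiffOn_infty_iff_deriv_of_isOpen isOpen_Ioo).1 h.smooth).2
  have hm := fun α => Icc_subset hr (h.profS_mem hr α)
  refine contDiff_const.div ?_ fun α => (h.deriv_pos _ (hm α)).ne'
  rw [contDiff_iff_contDiffAt]
  exact fun α => (hd.contDiffAt (isOpen_Ioo.mem_nhds (hm α))).comp α
    (h.contDiff_profS hr).contDiffAt

lemma profV_pos (h : IsOddIncreasing φ a) (hr : r ∈ Ioo 0 a) (α : ℝ) : 0 < profV φ a r α :=
  div_pos (h.map_pos hr) (h.deriv_pos _ (Icc_subset hr (h.profS_mem hr α)))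

/-- Differentiating `φ(s(α)) = φ(r) sin α` and dividing by `φ'`. -/
lemma hasDerivAt_profS (h : IsOddIncreasing φ a) (hr : r ∈ Ioo 0 a) (α : ℝ) :
    HasDerivAt (profS φ a r) (profV φ a r α * Real.cos α) α := by
  have hm := Icc_subset hr (h.profS_mem hr α)
  have hd : HasDerivAt (profS φ a r) (deriv (profS φ a r) α) α :=
    ((h.contDiff_profS hr).differentiable (by simp) α).hasDerivAt
  have h1 := (h.hasDerivAt hm).comp α hd
  have h2 : HasDerivAt (φ ∘ profS φ a r) (φ r * Real.cos α) α := by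
    rw [show φ ∘ profS φ a r = fun α => φ r * Real.sin α from funext (h.map_profS hr)]
    exact (Real.hasDerivAt_sin α).const_mul _
  have h3 := h1.unique h2
  refine hd.congr_deriv ?_
  have := (h.deriv_pos _ hm).ne'
  rw [profV]
  field_simp
  linarith

lemma hasDerivAt_profY (h : IsOddIncreasing φ a) (hr : r ∈ Ioo 0 a) (α : ℝ) :
    HasDerivAt (profY φ a r) (-(profV φ a r α * Real.sin α)) α := by
  have hc : Continuous fun t => profV φ a r t * Real.sin t :=
    (h.contDiff_profV hr).continuous.mul Real.continuous_sin
  exact intervalIntegral.integral_hasDerivAt_left (hc.intervalIntegrable _ _)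
    (hc.stronglyMeasurableAtFilter _ _) hc.continuousAt

lemma contDiff_profY (h : IsOddIncreasing φ a) (hr : r ∈ Ioo 0 a) :
    ContDiff ℝ ∞ (profY φ a r) := by
  rw [contDiff_infty_iff_deriv]
  refine ⟨fun α => (h.hasDerivAt_profY hr α).differentiableAt, ?_⟩
  rw [show deriv (profY φ a r) = fun α => -(profV φ a r α * Real.sin α) from
    funext fun α => (h.hasDerivAt_profY hr α).deriv]
  exact ((h.contDiff_profV hr).mul Real.contDiff_sin).neg

end IsOddIncreasing

/-! ### Symmetries, closedness and simplicity of the profile curve. -/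

lemma profS_congr {φ : ℝ → ℝ} {a r α β : ℝ} (hs : Real.sin α = Real.sin β) :
    profS φ a r α = profS φ a r β := by rw [profS, profS, hs]

lemma profV_congr {φ : ℝ → ℝ} {a r α β : ℝ} (hs : Real.sin α = Real.sin β) :
    profV φ a r α = profV φ a r β := by rw [profV, profV, profS_congr hs]

lemma profY_pi_div_two {φ : ℝ → ℝ} {a r : ℝ} : profY φ a r (Real.pi / 2) = 0 := by simp [profY]

namespace IsOddIncreasing

variable {φ : ℝ → ℝ} {a r : ℝ}

lemma profS_neg (h : IsOddIncreasing φ a) (hr : r ∈ Ioo 0 a) (α : ℝ) :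
    profS φ a r (-α) = -profS φ a r α := by
  have hm := Icc_subset hr (h.profS_mem hr α)
  have : φ r * Real.sin (-α) = φ (-profS φ a r α) := by
    rw [h.odd _ hm, h.map_profS hr, Real.sin_neg, mul_neg]
  rw [profS, this, h.profInv_apply ⟨by linarith [hm.2], by linarith [hm.1]⟩]

lemma profV_neg (h : IsOddIncreasing φ a) (hr : r ∈ Ioo 0 a) (α : ℝ) :
    profV φ a r (-α) = profV φ a r α := by
  rw [profV, profV, h.profS_neg hr, deriv_neg_of_odd h.odd (Icc_subset hr (h.profS_mem hr α))]

/-- Speed and sine are invariant under `α ↦ π - α`, so the sum of the two heights is constant; it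
vanishes at the fixed point `π/2`. -/
lemma profY_pi_sub (h : IsOddIncreasing φ a) (hr : r ∈ Ioo 0 a) (α : ℝ) :
    profY φ a r (Real.pi - α) = -profY φ a r α := by
  have hd : ∀ x, HasDerivAt (fun x => profY φ a r x + profY φ a r (Real.pi - x)) 0 x := by
    intro x
    refine ((h.hasDerivAt_profY hr x).add
      ((h.hasDerivAt_profY hr (Real.pi - x)).comp_const_sub Real.pi x)).congr_deriv ?_
    rw [profV_congr (Real.sin_pi_sub x), Real.sin_pi_sub]
    ring
  have := is_const_of_deriv_eq_zero (fun x => (hd x).differentiableAt) (fun x => (hd x).deriv)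
    α (Real.pi / 2)
  simp only [show Real.pi - Real.pi / 2 = Real.pi / 2 by ring, profY_pi_div_two] at this
  linarith

lemma profY_neg (h : IsOddIncreasing φ a) (hr : r ∈ Ioo 0 a) (α : ℝ) :
    profY φ a r (-α) = profY φ a r α := by
  have hd : ∀ x, HasDerivAt (fun x => profY φ a r x - profY φ a r (0 - x)) 0 x := by
    intro x
    refine ((h.hasDerivAt_profY hr x).sub
      ((h.hasDerivAt_profY hr (0 - x)).comp_const_sub 0 x)).congr_deriv ?_
    rw [zero_sub, h.profV_neg hr, Real.sin_neg]
    ring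
  have := is_const_of_deriv_eq_zero (fun x => (hd x).differentiableAt) (fun x => (hd x).deriv) α 0
  simp only [zero_sub, sub_self] at this
  linarith

/-- The reflections `α ↦ -α` and `α ↦ π - α` generate translation by `2π`, with two sign changes
that cancel. -/
lemma profY_periodic (h : IsOddIncreasing φ a) (hr : r ∈ Ioo 0 a) :
    Function.Periodic (profY φ a r) (2 * Real.pi) := fun α => by
  have h1 := h.profY_pi_sub hr (-(Real.pi + α))
  rw [h.profY_neg hr, show Real.pi - -(Real.pi + α) = α + 2 * Real.pi by ring] at h1
  have h2 := h.profY_pi_sub hr (-α)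
  rw [h.profY_neg hr, sub_neg_eq_add] at h2
  rw [h1, h2, neg_neg]

/-- The point of the profile curve depends on the angle modulo `2π` only. -/
lemma profY_congr (h : IsOddIncreasing φ a) (hr : r ∈ Ioo 0 a) {α β : ℝ}
    (he : Circle.exp α = Circle.exp β) : profY φ a r α = profY φ a r β := by
  obtain ⟨m, rfl⟩ := Circle.exp_eq_exp.1 he
  exact (h.profY_periodic hr).int_mul m β

lemma profY_pos_of_nonneg (h : IsOddIncreasing φ a) (hr : r ∈ Ioo 0 a) {α : ℝ}
    (h0 : 0 ≤ α) (h1 : α < Real.pi / 2) : 0 < profY φ a r α := by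
  have hanti : StrictAntiOn (profY φ a r) (Icc 0 (Real.pi / 2)) := by
    refine strictAntiOn_of_deriv_neg (convex_Icc _ _) (h.contDiff_profY hr).continuous.continuousOn
      fun x hx => ?_
    rw [interior_Icc] at hx
    rw [(h.hasDerivAt_profY hr x).deriv, neg_lt_zero]
    exact mul_pos (h.profV_pos hr x)
      (Real.sin_pos_of_pos_of_lt_pi hx.1 (by linarith [hx.2, Real.pi_pos]))
  have := hanti ⟨h0, h1.le⟩ (right_mem_Icc.2 (h0.trans h1.le)) h1
  rwa [profY_pi_div_two] at this

lemma profY_arcsin_pos (h : IsOddIncreasing φ a) (hr : r ∈ Ioo 0 a) {z : ℝ}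
    (hz : z ∈ Ioo (-1) 1) : 0 < profY φ a r (Real.arcsin z) := by
  have h1 := Real.arcsin_lt_pi_div_two.2 hz.2
  have h2 := Real.neg_pi_div_two_lt_arcsin.2 hz.1
  rcases le_total 0 (Real.arcsin z) with h0 | h0
  · exact h.profY_pos_of_nonneg hr h0 h1
  · rw [← h.profY_neg hr]
    exact h.profY_pos_of_nonneg hr (by linarith) (by linarith)

lemma profY_of_cos_nonneg (h : IsOddIncreasing φ a) (hr : r ∈ Ioo 0 a) {α : ℝ}
    (hα : 0 ≤ Real.cos α) : profY φ a r α = profY φ a r (Real.arcsin (Real.sin α)) := by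
  refine h.profY_congr hr (Circle.ext ?_)
  have hs := Real.sin_arcsin (Real.neg_one_le_sin α) (Real.sin_le_one α)
  have hc : Real.cos (Real.arcsin (Real.sin α)) = Real.cos α := by
    rw [Real.cos_arcsin, ← Real.cos_sq', Real.sqrt_sq hα]
  rw [Circle.coe_exp, Circle.coe_exp, Complex.exp_mul_I, Complex.exp_mul_I,
    ← Complex.ofReal_cos, ← Complex.ofReal_cos, ← Complex.ofReal_sin, ← Complex.ofReal_sin, hs, hc]

lemma profY_of_cos_nonpos (h : IsOddIncreasing φ a) (hr : r ∈ Ioo 0 a) {α : ℝ}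
    (hα : Real.cos α ≤ 0) : profY φ a r α = -profY φ a r (Real.arcsin (Real.sin α)) := by
  have := h.profY_of_cos_nonneg hr (α := Real.pi - α) (by rw [Real.cos_pi_sub]; linarith)
  rw [h.profY_pi_sub hr, Real.sin_pi_sub] at this
  linarith

lemma sin_mem_Ioo {α : ℝ} (hα : Real.cos α ≠ 0) : Real.sin α ∈ Ioo (-1) 1 := by
  have := Real.sin_sq_add_cos_sq α
  have h2 : 0 < Real.cos α ^ 2 := by positivity
  exact abs_lt.1 ((sq_lt_one_iff_abs_lt_one _).1 (by linarith))

lemma profY_pos (h : IsOddIncreasing φ a) (hr : r ∈ Ioo 0 a) {α : ℝ}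
    (hα : 0 < Real.cos α) : 0 < profY φ a r α := by
  rw [h.profY_of_cos_nonneg hr hα.le]
  exact h.profY_arcsin_pos hr (sin_mem_Ioo hα.ne')

lemma profY_lt_zero (h : IsOddIncreasing φ a) (hr : r ∈ Ioo 0 a) {α : ℝ}
    (hα : Real.cos α < 0) : profY φ a r α < 0 := by
  rw [h.profY_of_cos_nonpos hr hα.le, neg_lt_zero]
  exact h.profY_arcsin_pos hr (sin_mem_Ioo hα.ne)

lemma profY_of_cos_eq_zero (h : IsOddIncreasing φ a) (hr : r ∈ Ioo 0 a) {α : ℝ}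
    (hα : Real.cos α = 0) : profY φ a r α = 0 := by
  have h1 := h.profY_of_cos_nonneg hr hα.ge
  have h2 := h.profY_of_cos_nonpos hr hα.le
  linarith

/-- The profile curve is simple. -/
lemma exp_eq_of_prof_eq (h : IsOddIncreasing φ a) (hr : r ∈ Ioo 0 a) {α β : ℝ}
    (hS : profS φ a r α = profS φ a r β) (hY : profY φ a r α = profY φ a r β) :
    Circle.exp α = Circle.exp β := by
  have hs : Real.sin α = Real.sin β := by
    have := h.map_profS hr α
    rw [hS, h.map_profS hr] at this
    exact (mul_left_cancel₀ (h.map_pos hr).ne' this).symm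
  -- The cosines agree up to sign, and opposite nonzero signs would put the two points on opposite
  -- sides of `y = 0`.
  have hc : Real.cos α = Real.cos β := by
    have h2 : Real.cos α ^ 2 = Real.cos β ^ 2 := by rw [Real.cos_sq', Real.cos_sq', hs]
    rcases sq_eq_sq_iff_eq_or_eq_neg.1 h2 with h3 | h3
    · exact h3
    · rcases lt_trichotomy (Real.cos β) 0 with h4 | h4 | h4
      · have := h.profY_lt_zero hr h4
        have := h.profY_pos hr (α := α) (by linarith)
        linarith
      · linarith
      · have := h.profY_pos hr h4
        have := h.profY_lt_zero hr (α := α) (by linarith)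
        linarith
  refine Circle.ext ?_
  rw [Circle.coe_exp, Circle.coe_exp, Complex.exp_mul_I, Complex.exp_mul_I,
    ← Complex.ofReal_cos, ← Complex.ofReal_cos, ← Complex.ofReal_sin, ← Complex.ofReal_sin, hs, hc]

/-! ### The upper half of the curve as a graph. -/

lemma clamp_mem (hr : r ∈ Ioo 0 a) (x : ℝ) : max (-r) (min r x) ∈ Icc (-r) r :=
  ⟨le_max_left _ _, max_le (by linarith [hr.1]) (min_le_left _ _)⟩

lemma clamp_eq {x : ℝ} (hx : x ∈ Icc (-r) r) : max (-r) (min r x) = x := by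
  rw [min_eq_right hx.2, max_eq_right hx.1]

lemma continuous_height (h : IsOddIncreasing φ a) (hr : r ∈ Ioo 0 a) :
    Continuous (height φ a r) := by
  have h1 : Continuous fun x => φ (max (-r) (min r x)) :=
    (h.smooth.continuousOn.mono (Icc_subset hr)).comp_continuous (by fun_prop) (clamp_mem hr)
  exact (h.contDiff_profY hr).continuous.comp (Real.continuous_arcsin.comp (h1.div_const _))

lemma height_of_mem {x : ℝ} (hx : x ∈ Icc (-r) r) :
    height φ a r x = profY φ a r (Real.arcsin (φ x / φ r)) := by
  rw [height, clamp_eq hx]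

lemma height_of_notMem (h : IsOddIncreasing φ a) (hr : r ∈ Ioo 0 a) {x : ℝ}
    (hx : x ∉ Ioo (-r) r) : height φ a r x = 0 := by
  have hp := (h.map_pos hr).ne'
  have hm : r ∈ Ioo (-a) a := Icc_subset hr (right_mem_Icc.2 (by linarith [hr.1]))
  rcases le_or_gt x (-r) with h1 | h1
  · rw [height, max_eq_left ((min_le_right _ _).trans h1), h.odd r hm, neg_div, div_self hp,
      Real.arcsin_neg_one, h.profY_neg hr, profY_pi_div_two]
  · have h2 : r ≤ x := by
      by_contra! h2
      exact hx ⟨h1, h2⟩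
    rw [height, min_eq_left h2, max_eq_right (by linarith [hr.1]), div_self hp, Real.arcsin_one,
      profY_pi_div_two]

lemma ratio_mem (h : IsOddIncreasing φ a) (hr : r ∈ Ioo 0 a) {x : ℝ}
    (hx : x ∈ Ioo (-r) r) : φ x / φ r ∈ Ioo (-1) 1 := by
  have hp := h.map_pos hr
  have hm : r ∈ Ioo (-a) a := Icc_subset hr (right_mem_Icc.2 (by linarith [hr.1]))
  have hm' : -r ∈ Ioo (-a) a := Icc_subset hr (left_mem_Icc.2 (by linarith [hr.1]))
  have hxm := Icc_subset hr (Ioo_subset_Icc_self hx)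
  have h1 := h.strictMonoOn hxm hm hx.2
  have h2 := h.strictMonoOn hm' hxm hx.1
  rw [h.odd r hm] at h2
  exact ⟨by rw [lt_div_iff₀ hp]; linarith, by rw [div_lt_one hp]; exact h1⟩

lemma height_pos (h : IsOddIncreasing φ a) (hr : r ∈ Ioo 0 a) {x : ℝ}
    (hx : x ∈ Ioo (-r) r) : 0 < height φ a r x := by
  rw [height_of_mem (Ioo_subset_Icc_self hx)]
  exact h.profY_arcsin_pos hr (h.ratio_mem hr hx)

/-- The angle and `arcsin (sin α)` give the same `s`, and the same `y` up to the sign of `cos α`. -/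
lemma height_profS (h : IsOddIncreasing φ a) (hr : r ∈ Ioo 0 a) (α : ℝ) :
    height φ a r (profS φ a r α) = |profY φ a r α| := by
  rw [height_of_mem (h.profS_mem hr α), h.map_profS hr, mul_div_cancel_left₀ _ (h.map_pos hr).ne']
  rcases le_total 0 (Real.cos α) with hα | hα
  · rw [← h.profY_of_cos_nonneg hr hα]
    rcases hα.eq_or_lt with h0 | h0
    · rw [h.profY_of_cos_eq_zero hr h0.symm, abs_zero]
    · rw [abs_of_pos (h.profY_pos hr h0)]
  · rw [eq_neg_iff_add_eq_zero.2 (by linarith [h.profY_of_cos_nonpos hr hα] :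
      profY φ a r (Real.arcsin (Real.sin α)) + profY φ a r α = 0)]
    rcases hα.eq_or_lt with h0 | h0
    · rw [h.profY_of_cos_eq_zero hr h0, abs_zero, neg_zero]
    · rw [abs_of_neg (h.profY_lt_zero hr h0)]

/-- Every point of the graph of the height function and of its reflection is on the profile
curve. -/
lemma exists_prof_eq (h : IsOddIncreasing φ a) (hr : r ∈ Ioo 0 a) {x y : ℝ}
    (hx : x ∈ Icc (-r) r) (hy : |y| = height φ a r x) :
    ∃ α, profS φ a r α = x ∧ profY φ a r α = y := by
  have hp := h.map_pos hr
  have hxm := Icc_subset hr hx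
  have hz : φ x / φ r ∈ Icc (-1) 1 := by
    have hm : r ∈ Ioo (-a) a := Icc_subset hr (right_mem_Icc.2 (by linarith [hr.1]))
    have hm' : -r ∈ Ioo (-a) a := Icc_subset hr (left_mem_Icc.2 (by linarith [hr.1]))
    have h1 := h.strictMonoOn.monotoneOn hxm hm hx.2
    have h2 := h.strictMonoOn.monotoneOn hm' hxm hx.1
    rw [h.odd r hm] at h2
    exact ⟨by rw [le_div_iff₀ hp]; linarith, by rw [div_le_one hp]; exact h1⟩
  rw [height_of_mem hx] at hy
  have hS : profS φ a r (Real.arcsin (φ x / φ r)) = x := by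
    rw [profS, Real.sin_arcsin hz.1 hz.2, mul_div_cancel₀ _ hp.ne', h.profInv_apply hxm]
  rcases le_total 0 y with hy0 | hy0
  · exact ⟨_, hS, by rw [← hy, abs_of_nonneg hy0]⟩
  · refine ⟨Real.pi - Real.arcsin (φ x / φ r), ?_, ?_⟩
    · rw [profS_congr (Real.sin_pi_sub _), hS]
    · rw [h.profY_pi_sub hr, ← hy, abs_of_nonpos hy0, neg_neg]

/-- In the chain rule the factor `φ'(x)` cancels the one in the denominator of the speed, so the
slope involves only values of `φ`. -/
lemma hasDerivAt_height (h : IsOddIncreasing φ a) (hr : r ∈ Ioo 0 a) {x : ℝ}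
    (hx : x ∈ Ioo (-r) r) :
    HasDerivAt (height φ a r) (-(φ x / √(φ r ^ 2 - φ x ^ 2))) x := by
  have hp := h.map_pos hr
  have hz := h.ratio_mem hr hx
  have hxm := Icc_subset hr (Ioo_subset_Icc_self hx)
  have h1 : height φ a r =ᶠ[𝓝 x] fun x => profY φ a r (Real.arcsin (φ x / φ r)) := by
    filter_upwards [isOpen_Ioo.mem_nhds hx] with t ht using height_of_mem (Ioo_subset_Icc_self ht)
  refine HasDerivAt.congr_of_eventuallyEq ?_ h1
  have hS : profS φ a r (Real.arcsin (φ x / φ r)) = x := by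
    rw [profS, Real.sin_arcsin hz.1.le hz.2.le, mul_div_cancel₀ _ hp.ne', h.profInv_apply hxm]
  refine ((h.hasDerivAt_profY hr _).comp x ((Real.hasDerivAt_arcsin hz.1.ne' hz.2.ne).comp x
    ((h.hasDerivAt hxm).div_const (φ r)))).congr_deriv ?_
  have hd := (h.deriv_pos x hxm).ne'
  simp only [Function.comp_apply]
  rw [profV, hS, Real.sin_arcsin hz.1.le hz.2.le]
  have hsq : √(φ r ^ 2 - φ x ^ 2) = φ r * √(1 - (φ x / φ r) ^ 2) := by
    rw [show φ r ^ 2 - φ x ^ 2 = φ r ^ 2 * (1 - (φ x / φ r) ^ 2) by field_simp,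
      Real.sqrt_mul (by positivity), Real.sqrt_sq hp.le]
  have hpos : 0 < 1 - (φ x / φ r) ^ 2 := by nlinarith [hz.1, hz.2]
  have hne := (Real.sqrt_pos.2 hpos).ne'
  rw [hsq]
  field_simp

/-- The slope of the height function at a point of the profile curve. -/
lemma hasDerivAt_height_profS (h : IsOddIncreasing φ a) (hr : r ∈ Ioo 0 a) {α : ℝ}
    (hα : Real.cos α ≠ 0) :
    HasDerivAt (height φ a r) (-(Real.sin α / |Real.cos α|)) (profS φ a r α) := by
  have hp := h.map_pos hr
  have hsin := sin_mem_Ioo hα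
  have hx : profS φ a r α ∈ Ioo (-r) r := by
    have hm := h.profS_mem hr α
    have hφ := h.map_profS hr α
    have hrm : r ∈ Ioo (-a) a := Icc_subset hr (right_mem_Icc.2 (by linarith [hr.1]))
    refine ⟨lt_of_le_of_ne hm.1 fun he => ?_, lt_of_le_of_ne hm.2 fun he => ?_⟩
    · rw [← he, h.odd r hrm] at hφ
      nlinarith [hsin.1]
    · rw [he] at hφ
      nlinarith [hsin.2]
  refine (h.hasDerivAt_height hr hx).congr_deriv ?_
  rw [h.map_profS hr, show φ r ^ 2 - (φ r * Real.sin α) ^ 2 = (φ r * Real.cos α) ^ 2 by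
    rw [mul_pow, mul_pow, Real.cos_sq']; ring, Real.sqrt_sq_eq_abs, abs_mul, abs_of_pos hp,
    mul_div_mul_left _ _ hp.ne']

end IsOddIncreasing

/-! ### Topology of the region under a bump function. -/

/-- The rotationally symmetric region `|y| < u(s)` in `ℝ × S¹ × ℝ`. -/
def symRegion (u : ℝ → ℝ) : Set Tube := {q | |q.2.2| < u q.1}

/-- `u` is continuous, positive on `(-r, r)` and zero elsewhere. -/
structure IsBump (u : ℝ → ℝ) (r : ℝ) : Prop where
  pos_radius : 0 < r
  continuous : Continuous u
  pos : ∀ x ∈ Ioo (-r) r, 0 < u x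
  zero : ∀ x ∉ Ioo (-r) r, u x = 0

namespace IsBump

variable {u : ℝ → ℝ} {r : ℝ}

lemma isOpen_symRegion (h : IsBump u r) : IsOpen (symRegion u) :=
  isOpen_lt (by fun_prop) (h.continuous.comp continuous_fst)

lemma mem_Ioo (h : IsBump u r) {q : Tube} (hq : q ∈ symRegion u) : q.1 ∈ Ioo (-r) r := by
  by_contra hcon
  have h1 : |q.2.2| < u q.1 := hq
  rw [h.zero _ hcon] at h1
  exact absurd h1 (not_lt.2 (abs_nonneg _))

/-- Scaling each fibre by `u(s)` maps a standard box onto the region, so connectedness and the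
closure are inherited from the box. -/
lemma image_eq (h : IsBump u r) :
    (fun p : ℝ × Circle × ℝ => ((p.1, p.2.1, p.2.2 * u p.1) : Tube)) ''
      (Ioo (-r) r ×ˢ univ ×ˢ Ioo (-1) 1) = symRegion u := by
  ext ⟨s, z, y⟩
  constructor
  · rintro ⟨⟨s', z', t⟩, ⟨hs, -, ht⟩, he⟩
    simp only [Prod.mk.injEq] at he hs ht
    obtain ⟨rfl, rfl, rfl⟩ := he
    have hp := h.pos _ hs
    change |t * u s'| < u s'
    rw [abs_mul, abs_of_pos hp]
    exact mul_lt_of_lt_one_left hp (abs_lt.2 ht)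
  · intro hq
    have hs := h.mem_Ioo hq
    have hp := h.pos _ hs
    have hq' : |y| < u s := hq
    rw [abs_lt] at hq'
    refine ⟨(s, z, y / u s), ⟨hs, mem_univ _, ?_, ?_⟩, ?_⟩
    · change -1 < y / u s
      rw [lt_div_iff₀ hp]
      linarith
    · change y / u s < 1
      rw [div_lt_one hp]
      exact hq'.2
    · simp only [div_mul_cancel₀ _ hp.ne']

lemma isConnected_symRegion (h : IsBump u r) : IsConnected (symRegion u) := by
  rw [← h.image_eq]
  have hr := h.pos_radius
  refine IsConnected.image ?_ _ ?_
  · exact (isConnected_Ioo (by linarith)).prod (isConnected_univ.prod (isConnected_Ioo (by norm_num)))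
  · have := h.continuous
    exact Continuous.continuousOn (by fun_prop)

lemma isClosed_hull (h : IsBump u r) :
    IsClosed {q : Tube | q.1 ∈ Icc (-r) r ∧ |q.2.2| ≤ u q.1} :=
  (isClosed_Icc.preimage continuous_fst).inter
    (isClosed_le (by fun_prop) (h.continuous.comp continuous_fst))

lemma closure_symRegion (h : IsBump u r) :
    closure (symRegion u) = {q : Tube | q.1 ∈ Icc (-r) r ∧ |q.2.2| ≤ u q.1} := by
  have hr := h.pos_radius
  have hu := h.continuous
  apply subset_antisymm
  · exact closure_minimal (fun q hq => ⟨Ioo_subset_Icc_self (h.mem_Ioo hq),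
      (show |q.2.2| < u q.1 from hq).le⟩)
      h.isClosed_hull
  · rintro ⟨s, z, y⟩ ⟨hs, hy⟩
    have hcont : Continuous fun p : ℝ × Circle × ℝ => ((p.1, p.2.1, p.2.2 * u p.1) : Tube) := by
      fun_prop
    rw [← h.image_eq]
    refine image_closure_subset_closure_image hcont ?_
    rw [closure_prod_eq, closure_prod_eq, closure_univ, closure_Ioo (by linarith),
      closure_Ioo (by norm_num)]
    change |y| ≤ u s at hy
    by_cases h0 : u s = 0
    · rw [h0, abs_nonpos_iff] at hy
      exact ⟨(s, z, 0), ⟨hs, mem_univ _, by norm_num, by norm_num⟩, by simp [hy]⟩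
    · have hp : 0 < u s := lt_of_le_of_ne ((abs_nonneg y).trans hy) (Ne.symm h0)
      rw [abs_le] at hy
      refine ⟨(s, z, y / u s), ⟨hs, mem_univ _, ?_, ?_⟩, ?_⟩
      · change -1 ≤ y / u s
        rw [le_div_iff₀ hp]
        linarith
      · change y / u s ≤ 1
        rw [div_le_one hp]
        exact hy.2
      · simp only [div_mul_cancel₀ _ hp.ne']

lemma isCompact_closure (h : IsBump u r) : IsCompact (closure (symRegion u)) := by
  obtain ⟨B, hB⟩ := (isCompact_Icc (a := -r) (b := r)).exists_bound_of_continuousOn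
    h.continuous.continuousOn
  refine IsCompact.of_isClosed_subset
    (isCompact_Icc.prod (isCompact_univ.prod (isCompact_Icc (a := -B) (b := B)))) isClosed_closure
    (?_ : _ ⊆ Icc (-r) r ×ˢ univ ×ˢ Icc (-B) B)
  rw [h.closure_symRegion]
  rintro ⟨s, z, y⟩ ⟨hs, hy⟩
  exact ⟨hs, mem_univ _, abs_le.1 (hy.trans ((le_abs_self _).trans (hB s hs)))⟩

lemma interior_closure (h : IsBump u r) : interior (closure (symRegion u)) = symRegion u := by
  have hr := h.pos_radius
  refine subset_antisymm ?_ (h.isOpen_symRegion.subset_interior_iff.2 subset_closure)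
  rintro ⟨s, z, y⟩ hq
  have hcl := interior_subset hq
  rw [h.closure_symRegion] at hcl
  obtain ⟨hs, hy⟩ := hcl
  change s ∈ Icc (-r) r at hs
  change |y| ≤ u s at hy
  by_contra hcon
  have hye : |y| = u s := le_antisymm hy (not_lt.1 hcon)
  have hnhds := mem_interior_iff_mem_nhds.1 hq
  -- A boundary point is pushed out of the closure: over the open interval by enlarging `y`, at the
  -- end points by enlarging `s`.
  by_cases hsi : s ∈ Ioo (-r) r
  · have hc : ContinuousAt (fun t : ℝ => ((s, z, t * y) : Tube)) 1 := by fun_prop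
    have hev : ∀ᶠ t in 𝓝 (1 : ℝ), ((s, z, t * y) : Tube) ∈ closure (symRegion u) :=
      hc (by simpa using hnhds)
    obtain ⟨t, ht, ht1⟩ := ((hev.filter_mono nhdsWithin_le_nhds).and
      (self_mem_nhdsWithin : Ioi (1 : ℝ) ∈ 𝓝[>] 1)).exists
    rw [h.closure_symRegion] at ht
    have h2 : |t * y| ≤ u s := ht.2
    have hp := h.pos s hsi
    have ht1' : 1 < t := ht1
    rw [abs_mul, abs_of_pos (by linarith), hye] at h2
    nlinarith
  · have hc : ContinuousAt (fun t : ℝ => ((t * s, z, y) : Tube)) 1 := by fun_prop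
    have hev : ∀ᶠ t in 𝓝 (1 : ℝ), ((t * s, z, y) : Tube) ∈ closure (symRegion u) :=
      hc (by simpa using hnhds)
    obtain ⟨t, ht, ht1⟩ := ((hev.filter_mono nhdsWithin_le_nhds).and
      (self_mem_nhdsWithin : Ioi (1 : ℝ) ∈ 𝓝[>] 1)).exists
    rw [h.closure_symRegion] at ht
    have h2 : t * s ∈ Icc (-r) r := ht.1
    have ht1' : 1 < t := ht1
    rcases le_or_gt s (-r) with h3 | h3
    · nlinarith [h2.1]
    · have : r ≤ s := by
        by_contra! h4
        exact hsi ⟨h3, h4⟩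
      nlinarith [h2.2]

lemma frontier_symRegion (h : IsBump u r) :
    frontier (symRegion u) = {q : Tube | q.1 ∈ Icc (-r) r ∧ |q.2.2| = u q.1} := by
  rw [frontier, h.isOpen_symRegion.interior_eq, h.closure_symRegion]
  ext q
  constructor
  · rintro ⟨⟨h1, h2⟩, h3⟩
    exact ⟨h1, le_antisymm h2 (not_lt.1 h3)⟩
  · rintro ⟨h1, h2⟩
    exact ⟨⟨h1, h2.le⟩, fun h3 => absurd h2 (ne_of_lt h3)⟩

end IsBump

namespace IsOddIncreasing

variable {φ : ℝ → ℝ} {a r : ℝ}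

lemma isBump (h : IsOddIncreasing φ a) (hr : r ∈ Ioo 0 a) : IsBump (height φ a r) r where
  pos_radius := hr.1
  continuous := h.continuous_height hr
  pos _ hx := h.height_pos hr hx
  zero _ hx := h.height_of_notMem hr hx

/-- The bubble is obtained by rotating the profile curve. -/
lemma mem_frontier_iff (h : IsOddIncreasing φ a) (hr : r ∈ Ioo 0 a) {q : Tube} :
    q ∈ frontier (symRegion (height φ a r)) ↔
      ∃ α, profS φ a r α = q.1 ∧ profY φ a r α = q.2.2 := by
  rw [(h.isBump hr).frontier_symRegion]
  constructor
  · rintro ⟨h1, h2⟩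
    exact h.exists_prof_eq hr h1 h2
  · rintro ⟨α, h1, h2⟩
    refine ⟨h1 ▸ h.profS_mem hr α, ?_⟩
    rw [← h1, ← h2, h.height_profS hr]

end IsOddIncreasing

/-! ### Curvature of surfaces of revolution. -/

lemma Matrix.inv_diagonal_of_ne_zero {n : ℕ} {d : Fin n → ℝ} (hd : ∀ i, d i ≠ 0) :
    (Matrix.diagonal d)⁻¹ = Matrix.diagonal fun i => (d i)⁻¹ := by
  apply Matrix.inv_eq_right_inv
  rw [Matrix.diagonal_mul_diagonal, ← Matrix.diagonal_one]
  congr 1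
  ext i
  exact mul_inv_cancel₀ (hd i)

lemma partialD_comp_apply {n : ℕ} {g : ℝ → ℝ} {g' : ℝ} {u : Coord n} {i : Fin n} (a : Fin n)
    (hg : HasDerivAt g g' (u i)) :
    partialD a (fun w => g (w i)) u = g' * Pi.single (M := fun _ => ℝ) a 1 i := by
  have h1 : HasFDerivAt (fun w : Coord n => w i)
      (ContinuousLinearMap.proj (R := ℝ) (φ := fun _ : Fin n => ℝ) i) u :=
    (ContinuousLinearMap.proj (R := ℝ) (φ := fun _ : Fin n => ℝ) i).hasFDerivAt
  change fderiv ℝ (g ∘ fun w => w i) u (Pi.single a 1) = _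
  rw [(hg.comp_hasFDerivAt u h1).fderiv]
  simp

lemma partialD_tubeMetric {c f' : ℝ} {f : ℝ → ℝ} {p : Coord 3} (hf : HasDerivAt f f' (p 0))
    (i j l : Fin 3) : partialD i (fun q => tubeMetric c f q j l) p =
      if i = 0 ∧ j = 1 ∧ l = 1 then 2 * c ^ 2 * f (p 0) * f' else 0 := by
  by_cases hjl : j = 1 ∧ l = 1
  · obtain ⟨rfl, rfl⟩ := hjl
    have h1 : HasDerivAt (fun s => c ^ 2 * f s ^ 2) (2 * c ^ 2 * f (p 0) * f') (p 0) := by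
      refine ((hf.pow 2).const_mul (c ^ 2)).congr_deriv ?_
      push_cast
      ring
    have h2 := partialD_comp_apply (u := p) (i := 0) i h1
    simp only [tubeMetric, Matrix.diagonal_apply_eq, Matrix.cons_val_one, Matrix.cons_val_zero]
    rw [h2]
    fin_cases i <;> simp
  · have h0 : (fun q => tubeMetric c f q j l) = fun _ => tubeMetric c f p j l := by
      ext q
      fin_cases j <;> fin_cases l <;> simp [tubeMetric] at hjl ⊢
    rw [h0, if_neg fun h => hjl h.2]
    simp [partialD]

lemma christoffel_tubeMetric {c f' : ℝ} {f : ℝ → ℝ} {p : Coord 3} (hc : c ≠ 0)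
    (hf : HasDerivAt f f' (p 0)) (hf0 : f (p 0) ≠ 0) (k i j : Fin 3) :
    christoffel (tubeMetric c f) p k i j =
      if k = 1 ∧ (i = 0 ∧ j = 1 ∨ i = 1 ∧ j = 0) then f' / f (p 0)
      else if k = 0 ∧ i = 1 ∧ j = 1 then -(c ^ 2 * f (p 0) * f') else 0 := by
  have hinv : (tubeMetric c f p)⁻¹ =
      Matrix.diagonal fun i => (![1, c ^ 2 * f (p 0) ^ 2, 1] i : ℝ)⁻¹ := by
    rw [tubeMetric]
    apply Matrix.inv_diagonal_of_ne_zero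
    intro i
    fin_cases i <;> simp [hc, hf0]
  rw [christoffel, hinv]
  simp only [partialD_tubeMetric hf, Fin.sum_univ_three]
  fin_cases k <;> fin_cases i <;> fin_cases j <;> simp <;> field_simp

section Revolution

variable {σ η v : ℝ → ℝ}

/-- The surface of revolution (in the coordinates `(s, θ, y)`) with profile curve `(σ, η)`. -/
def revSurface (σ η : ℝ → ℝ) (w : Coord 2) : Coord 3 := ![σ (w 0), w 1, η (w 0)]

/-- The unit normal of the surface of revolution whose profile curve has direction
`(cos α, -sin α)` at the parameter `α`. -/
noncomputable def revNormal (w : Coord 2) : Coord 3 := ![Real.sin (w 0), 0, Real.cos (w 0)]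

lemma contDiff_revNormal : ContDiff ℝ ∞ revNormal := by
  rw [contDiff_pi]
  intro i
  fin_cases i
  · exact Real.contDiff_sin.comp (contDiff_apply ℝ ℝ 0)
  · exact contDiff_const
  · exact Real.contDiff_cos.comp (contDiff_apply ℝ ℝ 0)

lemma contDiff_revSurface (hσ : ContDiff ℝ ∞ σ) (hη : ContDiff ℝ ∞ η) :
    ContDiff ℝ ∞ (revSurface σ η) := by
  rw [contDiff_pi]
  intro i
  fin_cases i
  · exact hσ.comp (contDiff_apply ℝ ℝ 0)
  · exact contDiff_apply ℝ ℝ 1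
  · exact hη.comp (contDiff_apply ℝ ℝ 0)

lemma tangentVec_revSurface_zero
    (hσ : ∀ α, HasDerivAt σ (v α * Real.cos α) α)
    (hη : ∀ α, HasDerivAt η (-(v α * Real.sin α)) α)
    (w : Coord 2) : tangentVec (revSurface σ η) 0 w =
    ![v (w 0) * Real.cos (w 0), 0, -(v (w 0) * Real.sin (w 0))] := by
  ext k
  fin_cases k
  · simpa [tangentVec, revSurface] using partialD_comp_apply (u := w) 0 (hσ (w 0))
  · simpa [tangentVec, revSurface] using partialD_comp_apply (u := w) (i := 1) 0 (hasDerivAt_id (w 1))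
  · simpa [tangentVec, revSurface] using partialD_comp_apply (u := w) 0 (hη (w 0))

lemma tangentVec_revSurface_one
    (hσ : ∀ α, HasDerivAt σ (v α * Real.cos α) α)
    (hη : ∀ α, HasDerivAt η (-(v α * Real.sin α)) α)
    (w : Coord 2) :
    tangentVec (revSurface σ η) 1 w = ![0, 1, 0] := by
  ext k
  fin_cases k
  · simpa [tangentVec, revSurface] using partialD_comp_apply (u := w) 1 (hσ (w 0))
  · simpa [tangentVec, revSurface] using partialD_comp_apply (u := w) (i := 1) 1 (hasDerivAt_id (w 1))
  · simpa [tangentVec, revSurface] using partialD_comp_apply (u := w) 1 (hη (w 0))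

lemma isUnitNormalAlong_revSurface
    (hσ : ∀ α, HasDerivAt σ (v α * Real.cos α) α)
    (hη : ∀ α, HasDerivAt η (-(v α * Real.sin α)) α)
    (c : ℝ) (f : ℝ → ℝ) (U : Set (Coord 2)) :
    IsUnitNormalAlong (tubeMetric c f) (revSurface σ η) revNormal U := by
  refine ⟨contDiff_revNormal.contDiffOn, fun w _ => ⟨?_, fun b => ?_⟩⟩
  · simp only [gInner, tubeMetric, revNormal, Fin.sum_univ_three]
    simp
    linarith [Real.sin_sq_add_cos_sq (w 0)]
  · fin_cases b
    · simp only [Fin.zero_eta, tangentVec_revSurface_zero hσ hη]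
      simp only [gInner, tubeMetric, revNormal, Fin.sum_univ_three]
      simp
      ring
    · simp only [Fin.mk_one, tangentVec_revSurface_one hσ hη]
      simp only [gInner, tubeMetric, revNormal, Fin.sum_univ_three]
      simp

/-- The two coordinate tangent vectors are independent because `v > 0` and `sin`, `cos` have no
common zero. -/
lemma injective_fderiv_revSurface
    (hσ : ∀ α, HasDerivAt σ (v α * Real.cos α) α)
    (hη : ∀ α, HasDerivAt η (-(v α * Real.sin α)) α)
    (hσs : ContDiff ℝ ∞ σ) (hηs : ContDiff ℝ ∞ η)
    (hv : ∀ α, 0 < v α) (w : Coord 2) : Function.Injective (fderiv ℝ (revSurface σ η) w) := by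
  have hd : DifferentiableAt ℝ (revSurface σ η) w :=
    (contDiff_revSurface hσs hηs).differentiable (by simp) w
  rw [injective_iff_map_eq_zero]
  intro x hx
  have hk : ∀ k, x 0 * tangentVec (revSurface σ η) 0 w k +
      x 1 * tangentVec (revSurface σ η) 1 w k = 0 := by
    intro k
    have h1 : ∀ z, fderiv ℝ (fun w => revSurface σ η w k) w z = fderiv ℝ (revSurface σ η) w z k := by
      intro z
      rw [(hasFDerivAt_pi'.1 hd.hasFDerivAt k).fderiv]
      rfl
    have h2 : x = x 0 • Pi.single 0 1 + x 1 • Pi.single 1 1 := by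
      ext i
      fin_cases i <;> simp
    simp only [tangentVec, partialD, h1]
    have h3 := congrFun hx k
    rw [h2, map_add, map_smul, map_smul] at h3
    simpa using h3
  simp only [tangentVec_revSurface_zero hσ hη, tangentVec_revSurface_one hσ hη] at hk
  have e0 := hk 0
  have e1 := hk 1
  have e2 := hk 2
  simp at e0 e1 e2
  have hx0 : x 0 = 0 := by
    by_contra hne
    have hv0 := (hv (w 0)).ne'
    have hc : Real.cos (w 0) = 0 := by tauto
    have hs : Real.sin (w 0) = 0 := by tauto
    have := Real.sin_sq_add_cos_sq (w 0)
    rw [hc, hs] at this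
    norm_num at this
  ext i
  fin_cases i
  · exact hx0
  · exact e1

lemma covDerivAlong_revNormal_zero
    (hσ : ∀ α, HasDerivAt σ (v α * Real.cos α) α)
    (hη : ∀ α, HasDerivAt η (-(v α * Real.sin α)) α)
    {c f' : ℝ} {f : ℝ → ℝ} {w : Coord 2} (hc : c ≠ 0)
    (hf : HasDerivAt f f' (σ (w 0))) (hf0 : f (σ (w 0)) ≠ 0) :
    covDerivAlong (tubeMetric c f) (revSurface σ η) revNormal 0 w =
      ![Real.cos (w 0), 0, -Real.sin (w 0)] := by
  have e0 := partialD_comp_apply (u := w) (i := 0) 0 (Real.hasDerivAt_sin (w 0))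
  have e2 := partialD_comp_apply (u := w) (i := 0) 0 (Real.hasDerivAt_cos (w 0))
  have e1 := partialD_comp_apply (u := w) (i := 0) 0 (hasDerivAt_const (w 0) (0 : ℝ))
  ext k
  simp only [covDerivAlong, christoffel_tubeMetric (p := revSurface σ η w) hc hf hf0,
    tangentVec_revSurface_zero hσ hη, Fin.sum_univ_three]
  fin_cases k
  · simpa [revNormal] using e0
  · simpa [revNormal] using e1
  · simpa [revNormal] using e2

lemma covDerivAlong_revNormal_one
    (hσ : ∀ α, HasDerivAt σ (v α * Real.cos α) α)
    (hη : ∀ α, HasDerivAt η (-(v α * Real.sin α)) α)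
    {c f' : ℝ} {f : ℝ → ℝ} {w : Coord 2} (hc : c ≠ 0)
    (hf : HasDerivAt f f' (σ (w 0))) (hf0 : f (σ (w 0)) ≠ 0) :
    covDerivAlong (tubeMetric c f) (revSurface σ η) revNormal 1 w =
      ![0, f' / f (σ (w 0)) * Real.sin (w 0), 0] := by
  have e0 := partialD_comp_apply (u := w) (i := 0) 1 (Real.hasDerivAt_sin (w 0))
  have e2 := partialD_comp_apply (u := w) (i := 0) 1 (Real.hasDerivAt_cos (w 0))
  have e1 := partialD_comp_apply (u := w) (i := 0) 1 (hasDerivAt_const (w 0) (0 : ℝ))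
  ext k
  simp only [covDerivAlong, christoffel_tubeMetric (p := revSurface σ η w) hc hf hf0,
    tangentVec_revSurface_one hσ hη, Fin.sum_univ_three]
  fin_cases k
  · simpa [revNormal] using e0
  · simpa [revNormal, revSurface] using e1
  · simpa [revNormal] using e2

/-- The mean curvature of a surface of revolution. -/
lemma meanCurv_revSurface
    (hσ : ∀ α, HasDerivAt σ (v α * Real.cos α) α)
    (hη : ∀ α, HasDerivAt η (-(v α * Real.sin α)) α)
    {c f' : ℝ} {f : ℝ → ℝ} {w : Coord 2} (hc : c ≠ 0)
    (hv : v (w 0) ≠ 0) (hf : HasDerivAt f f' (σ (w 0))) (hf0 : f (σ (w 0)) ≠ 0) :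
    meanCurv (tubeMetric c f) (revSurface σ η) revNormal w =
      1 / v (w 0) + f' / f (σ (w 0)) * Real.sin (w 0) := by
  have hfirst : firstForm (tubeMetric c f) (revSurface σ η) w =
      Matrix.diagonal ![v (w 0) ^ 2, c ^ 2 * f (σ (w 0)) ^ 2] := by
    ext i j
    fin_cases i <;> fin_cases j <;>
      simp [firstForm, tangentVec_revSurface_zero hσ hη, tangentVec_revSurface_one hσ hη,
        gInner, tubeMetric, Fin.sum_univ_three, revSurface]
    linear_combination v (w 0) ^ 2 * Real.sin_sq_add_cos_sq (w 0)
  have hsecond : secondForm (tubeMetric c f) (revSurface σ η) revNormal w =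
      Matrix.diagonal ![v (w 0), c ^ 2 * f (σ (w 0)) * f' * Real.sin (w 0)] := by
    ext i j
    fin_cases i <;> fin_cases j <;>
      simp [secondForm, tangentVec_revSurface_zero hσ hη, tangentVec_revSurface_one hσ hη,
        covDerivAlong_revNormal_zero hσ hη hc hf hf0, covDerivAlong_revNormal_one hσ hη hc hf hf0,
        gInner, tubeMetric, Fin.sum_univ_three, revSurface]
    · linear_combination v (w 0) * Real.sin_sq_add_cos_sq (w 0)
    · field_simp
  rw [meanCurv, hfirst, hsecond, Matrix.inv_diagonal_of_ne_zero, Matrix.diagonal_mul_diagonal,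
    Matrix.trace_diagonal, Fin.sum_univ_two]
  · simp
    field_simp
  · intro i
    fin_cases i <;> simp [hc, hv, hf0]

end Revolution

/-! ### Embedded parametrizations, the outward normal and the mean curvature. -/

/-- A function vanishing at `0` with positive derivative is negative just before `0` and
positive just after it. -/
lemma HasDerivAt.eventually_neg_pos {k : ℝ → ℝ} {k' : ℝ} (hk : HasDerivAt k k' 0) (hk0 : k 0 = 0)
    (hpos : 0 < k') : ∀ᶠ t in 𝓝[>] (0 : ℝ), k (-t) < 0 ∧ 0 < k t := by
  have hev := (hasDerivAt_iff_tendsto_slope_zero.1 hk).eventually (lt_mem_nhds hpos)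
  have h1 : ∀ᶠ t in 𝓝[>] (0 : ℝ), 0 < t⁻¹ • (k (0 + t) - k 0) :=
    hev.filter_mono (nhdsGT_le_nhdsNE 0)
  have hneg : Tendsto (fun t : ℝ => -t) (𝓝[>] 0) (𝓝[≠] 0) := by
    refine tendsto_nhdsWithin_iff.2 ⟨?_, ?_⟩
    · have : Tendsto (fun t : ℝ => -t) (𝓝 0) (𝓝 0) := by
        simpa using (continuous_neg (G := ℝ)).tendsto 0
      exact this.mono_left nhdsWithin_le_nhds
    · filter_upwards [self_mem_nhdsWithin] with t ht
      exact neg_ne_zero.2 (show (0 : ℝ) < t from ht).ne'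
  filter_upwards [h1, hneg.eventually hev, self_mem_nhdsWithin] with t h2 h3 ht
  have ht' : 0 < t := ht
  rw [zero_add, hk0, sub_zero, smul_eq_mul] at h2 h3
  constructor
  · rw [inv_neg, neg_mul, neg_pos] at h3
    by_contra! hcon
    exact absurd h3 (not_lt.2 (mul_nonneg (inv_nonneg.2 ht'.le) hcon))
  · exact (mul_pos_iff_of_pos_left (inv_pos.2 ht')).1 h2

lemma isEmbedding_circleExp_Ioo (β : ℝ) :
    IsEmbedding ((Ioo (β - Real.pi) (β + Real.pi)).domRestrict Circle.exp) := by
  refine (IsOpenEmbedding.of_continuous_injective_isOpenMap ?_ ?_ ?_).isEmbedding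
  · exact (Circle.exp.continuous).comp continuous_subtype_val
  · rw [← injOn_iff_injective]
    exact (Circle.exp_injOn_Ioc (by linarith)).mono Ioo_subset_Ioc_self
  · exact isLocalHomeomorph_circleExp.isOpenMap.domRestrict isOpen_Ioo

lemma Circle.exists_Ioc_exp_eq (β : ℝ) (z : Circle) :
    ∃ α ∈ Ioc (β - Real.pi) (β + Real.pi), Circle.exp α = z := by
  refine ⟨Complex.arg (z / Circle.exp β : Circle) + β, ⟨?_, ?_⟩, ?_⟩
  · linarith [Complex.neg_pi_lt_arg (z / Circle.exp β : Circle)]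
  · linarith [Complex.arg_le_pi (z / Circle.exp β : Circle)]
  · rw [Circle.exp_add, Circle.exp_arg, div_mul_cancel]

/-- The profile curve as a map on the circle. -/
noncomputable def profCircle (φ : ℝ → ℝ) (a r : ℝ) (z : Circle) : ℝ × ℝ :=
  (profS φ a r (Complex.arg z), profY φ a r (Complex.arg z))

namespace IsOddIncreasing

variable {φ : ℝ → ℝ} {a r : ℝ}

lemma profS_congr_exp {α β : ℝ} (he : Circle.exp α = Circle.exp β) :
    profS φ a r α = profS φ a r β := by
  obtain ⟨m, rfl⟩ := Circle.exp_eq_exp.1 he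
  exact profS_congr (Real.sin_periodic.int_mul m β)

lemma profCircle_exp (h : IsOddIncreasing φ a) (hr : r ∈ Ioo 0 a) (α : ℝ) :
    profCircle φ a r (Circle.exp α) = (profS φ a r α, profY φ a r α) := by
  have := Circle.exp_arg (Circle.exp α)
  rw [profCircle, profS_congr_exp this, h.profY_congr hr this]

lemma isEmbedding_profCircle (h : IsOddIncreasing φ a) (hr : r ∈ Ioo 0 a) :
    IsEmbedding (profCircle φ a r) := by
  -- `Complex.arg` jumps, so continuity on the circle is checked after pulling back along the
  -- quotient map `Circle.exp`.
  have hq : IsQuotientMap Circle.exp :=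
    isLocalHomeomorph_circleExp.isOpenMap.isQuotientMap Circle.exp.continuous
      Circle.leftInverse_exp_arg.surjective
  have hcont : Continuous (profCircle φ a r) := by
    rw [hq.continuous_iff, show profCircle φ a r ∘ Circle.exp = fun α =>
      (profS φ a r α, profY φ a r α) from funext (h.profCircle_exp hr)]
    exact (h.contDiff_profS hr).continuous.prodMk (h.contDiff_profY hr).continuous
  refine (hcont.isClosedEmbedding fun z w hzw => ?_).isEmbedding
  rw [← Circle.exp_arg z, ← Circle.exp_arg w, h.profCircle_exp hr, h.profCircle_exp hr,
    Prod.mk.injEq] at hzw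
  rw [← Circle.exp_arg z, ← Circle.exp_arg w]
  exact h.exp_eq_of_prof_eq hr hzw.1 hzw.2

/-- Up to reordering coordinates, this is an open arc of the embedded profile circle times the
identity of the `θ`-line. -/
lemma isEmbedding_revSurface (h : IsOddIncreasing φ a) (hr : r ∈ Ioo 0 a) (β : ℝ) :
    IsEmbedding (({w | w 0 ∈ Ioo (β - Real.pi) (β + Real.pi)} : Set (Coord 2)).domRestrict
      (revSurface (profS φ a r) (profY φ a r))) := by
  set J := Ioo (β - Real.pi) (β + Real.pi)
  set U : Set (Coord 2) := {w | w 0 ∈ J}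
  have hX : Continuous (revSurface (profS φ a r) (profY φ a r)) :=
    (contDiff_revSurface (h.contDiff_profS hr) (h.contDiff_profY hr)).continuous
  let D : U → J × ℝ := fun w => (⟨w.1 0, w.2⟩, w.1 1)
  have hDc : Continuous D :=
    (Continuous.subtype_mk ((continuous_apply 0).comp continuous_subtype_val) _).prodMk
      ((continuous_apply 1).comp continuous_subtype_val)
  have hD : IsEmbedding D := by
    have hE : Continuous fun q : J × ℝ => (![(q.1 : ℝ), q.2] : Coord 2) := by fun_prop
    refine IsEmbedding.of_comp hDc hE ?_
    convert (IsEmbedding.subtypeVal : IsEmbedding (Subtype.val : U → Coord 2)) using 1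
    ext w i
    fin_cases i <;> rfl
  have hP : Continuous fun p : Coord 3 => ((p 0, p 2), p 1) := by fun_prop
  refine IsEmbedding.of_comp (hX.comp continuous_subtype_val) hP ?_
  convert ((((h.isEmbedding_profCircle hr).comp (isEmbedding_circleExp_Ioo β)).prodMap
    (IsEmbedding.id (X := ℝ))).comp hD) using 1
  ext1 w
  simp only [Function.comp_apply, D, Prod.map_apply, domRestrict_apply, h.profCircle_exp hr]
  rfl

/-- An open interval of angles of length `2π` misses exactly one point of the profile curve, the one
at `β + π`, and the target omits that point. -/
lemma isLocalParam_revSurface (h : IsOddIncreasing φ a) (hr : r ∈ Ioo 0 a) (β : ℝ) :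
    IsLocalParam (cover ⁻¹' frontier (symRegion (height φ a r)))
      {w | w 0 ∈ Ioo (β - Real.pi) (β + Real.pi)}
      {p | (p 0, p 2) ≠ (profS φ a r (β + Real.pi), profY φ a r (β + Real.pi))}
      (revSurface (profS φ a r) (profY φ a r)) where
  isOpen_source := isOpen_Ioo.preimage (continuous_apply 0)
  isOpen_target := isOpen_ne_fun (by fun_prop) continuous_const
  smooth := (contDiff_revSurface (h.contDiff_profS hr) (h.contDiff_profY hr)).contDiffOn
  regular w _ := injective_fderiv_revSurface (h.hasDerivAt_profS hr) (h.hasDerivAt_profY hr)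
    (h.contDiff_profS hr) (h.contDiff_profY hr) (h.profV_pos hr) w
  image_eq := by
    have hpi := Real.pi_pos
    ext p
    constructor
    · rintro ⟨w, hw, rfl⟩
      refine ⟨(h.mem_frontier_iff hr).2 ⟨w 0, rfl, rfl⟩, fun he => ?_⟩
      have he' : profS φ a r (w 0) = profS φ a r (β + Real.pi) ∧
        profY φ a r (w 0) = profY φ a r (β + Real.pi) := Prod.mk.injEq _ _ _ _ ▸ he
      have h1 := Circle.exp_injOn_Ioc (by linarith) (Ioo_subset_Ioc_self hw)
        (right_mem_Ioc.2 (by linarith)) (h.exp_eq_of_prof_eq hr he'.1 he'.2)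
      exact absurd h1 hw.2.ne
    · rintro ⟨hp, hne⟩
      obtain ⟨α, hS, hY⟩ := (h.mem_frontier_iff hr).1 hp
      change profS φ a r α = p 0 at hS
      change profY φ a r α = p 2 at hY
      obtain ⟨α', hα', he⟩ := Circle.exists_Ioc_exp_eq β (Circle.exp α)
      have hS' := (profS_congr_exp he).trans hS
      have hY' := (h.profY_congr hr he).trans hY
      have hα'2 : α' ≠ β + Real.pi := by
        rintro rfl
        exact hne (by rw [hS', hY'])
      refine ⟨![α', p 1], ⟨hα'.1, lt_of_le_of_ne hα'.2 hα'2⟩, ?_⟩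
      ext i
      fin_cases i
      · exact hS'
      · rfl
      · exact hY'
  isEmbedding := h.isEmbedding_revSurface hr β

/-- The normal of the rotated profile curve points out of the region that it encloses. -/
lemma pointsOutOf_revNormal (h : IsOddIncreasing φ a) (hr : r ∈ Ioo 0 a) (U : Set (Coord 2)) :
    PointsOutOf (symRegion (height φ a r)) (revSurface (profS φ a r) (profY φ a r))
      revNormal U := by
  intro w _
  set α := w 0 with hα
  suffices hmain : ∀ᶠ t in 𝓝[>] (0 : ℝ),
      |profY φ a r α - t * Real.cos α| < height φ a r (profS φ a r α - t * Real.sin α) ∧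
      ¬ (profS φ a r α + t * Real.sin α ∈ Icc (-r) r ∧
        |profY φ a r α + t * Real.cos α| ≤ height φ a r (profS φ a r α + t * Real.sin α)) by
    filter_upwards [hmain] with t ht
    rw [(h.isBump hr).closure_symRegion]
    exact ht
  -- At the tips `s = ±r` the height function offers no slope, but the normal is parallel to the
  -- `s`-axis and the sign of `t` decides directly. Elsewhere `|y| - u(s)` vanishes at `t = 0` and
  -- is shown to have positive derivative along the normal.
  by_cases hc : Real.cos α = 0
  · have hrm : r ∈ Icc (-r) r := right_mem_Icc.2 (by linarith [hr.1])
    have hS : profS φ a r α = r * Real.sin α ∧ (Real.sin α = 1 ∨ Real.sin α = -1) := by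
      have h1 : Real.sin α ^ 2 = 1 := by rw [Real.sin_sq, hc]; norm_num
      rcases sq_eq_one_iff.1 h1 with h2 | h2
      · exact ⟨by rw [profS, h2, mul_one, mul_one, h.profInv_apply (Icc_subset hr hrm)], .inl h2⟩
      · refine ⟨?_, .inr h2⟩
        rw [profS, h2, mul_neg_one, mul_neg_one, ← h.odd r (Icc_subset hr hrm), h.profInv_apply
          (Icc_subset hr (left_mem_Icc.2 (by linarith [hr.1])))]
    rw [hS.1, h.profY_of_cos_eq_zero hr hc, hc]
    filter_upwards [Ioo_mem_nhdsGT hr.1] with t ht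
    rw [mul_zero, sub_zero, abs_zero]
    refine ⟨h.height_pos hr ?_, fun hcon => ?_⟩
    · rcases hS.2 with h2 | h2 <;> rw [h2] <;> constructor <;> linarith [ht.1, ht.2]
    · have h3 := hcon.1
      rcases hS.2 with h2 | h2 <;> rw [h2] at h3
      · linarith [h3.2, ht.1]
      · linarith [h3.1, ht.1]
  · have hY : HasDerivAt (fun t => |profY φ a r α + t * Real.cos α|) |Real.cos α| 0 := by
      have h1 : HasDerivAt (fun t => profY φ a r α + t * Real.cos α) (Real.cos α) 0 := by
        simpa using ((hasDerivAt_id (0 : ℝ)).mul_const (Real.cos α)).const_add (profY φ a r α)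
      rcases lt_or_gt_of_ne hc with h2 | h2
      · have h3 := h.profY_lt_zero hr h2
        have h4 := (hasDerivAt_abs_neg (x := profY φ a r α + 0 * Real.cos α) (by simpa)).comp 0 h1
        rw [abs_of_neg h2]
        simpa [Function.comp_def] using h4
      · have h3 := h.profY_pos hr h2
        have h4 := (hasDerivAt_abs_pos (x := profY φ a r α + 0 * Real.cos α) (by simpa)).comp 0 h1
        rw [abs_of_pos h2]
        simpa [Function.comp_def] using h4
    have hH : HasDerivAt (fun t => height φ a r (profS φ a r α + t * Real.sin α))
        (-(Real.sin α / |Real.cos α|) * Real.sin α) 0 := by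
      have h1 : HasDerivAt (fun t => profS φ a r α + t * Real.sin α) (Real.sin α) 0 := by
        simpa using ((hasDerivAt_id (0 : ℝ)).mul_const (Real.sin α)).const_add (profS φ a r α)
      have h2 := h.hasDerivAt_height_profS hr hc
      have h3 : HasDerivAt (height φ a r) (-(Real.sin α / |Real.cos α|))
          (profS φ a r α + 0 * Real.sin α) := by simpa using h2
      have h4 := h3.comp (0 : ℝ) h1
      exact h4
    have hpos : 0 < |Real.cos α| - -(Real.sin α / |Real.cos α|) * Real.sin α := by
      have h1 := abs_pos.2 hc
      have h2 : 0 ≤ Real.sin α / |Real.cos α| * Real.sin α := by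
        rw [div_mul_eq_mul_div]
        exact div_nonneg (mul_self_nonneg _) h1.le
      linarith
    have hk := (hY.sub hH).eventually_neg_pos (by simp [h.height_profS hr]) hpos
    filter_upwards [hk] with t ht
    obtain ⟨h1, h2⟩ := ht
    simp only [Pi.sub_apply, neg_mul, ← sub_eq_add_neg] at h1 h2
    exact ⟨by linarith, fun hcon => by linarith [hcon.2]⟩

end IsOddIncreasing

/-- With `1/v = φ'(s)/φ(r)` and `sin α = φ(s)/φ(r)`, the mean curvature is `(φ' + φ f'/f)/φ(r)`,
whose numerator is `1`. The parametrization is centred at the angle `β` of the given point, so the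
omitted point is the one half a turn away. -/
lemma IsWarping.hasConstMeanCurv {f : ℝ → ℝ} {b a r c : ℝ} (hf : IsWarping f b) (hab : a < b)
    (h : IsOddIncreasing (phiFun f) a) (hr : r ∈ Ioo 0 a) (hc : 0 < c) :
    HasConstMeanCurv (tubeMetric c f) (frontier (symRegion (height (phiFun f) a r)))
      (symRegion (height (phiFun f) a r)) (1 / phiFun f r) := by
  intro p hp
  obtain ⟨β, hS, hY⟩ := (h.mem_frontier_iff hr).1 hp
  change profS (phiFun f) a r β = p 0 at hS
  change profY (phiFun f) a r β = p 2 at hY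
  have hpi := Real.pi_pos
  refine ⟨_, _, _, revNormal, ?_, h.isLocalParam_revSurface hr β,
    isUnitNormalAlong_revSurface (h.hasDerivAt_profS hr) (h.hasDerivAt_profY hr) c f _,
    h.pointsOutOf_revNormal hr _, fun w _ => ?_⟩
  · intro he
    rw [← hS, ← hY, Prod.mk.injEq] at he
    have h1 := Circle.exp_injOn_Ico (a := β) (b := β + 2 * Real.pi) (by linarith)
      (left_mem_Ico.2 (by linarith)) ⟨by linarith, by linarith⟩
      (h.exp_eq_of_prof_eq hr he.1 he.2)
    linarith
  · have hm := IsOddIncreasing.Icc_subset hr (h.profS_mem hr (w 0))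
    have hm' : profS (phiFun f) a r (w 0) ∈ Ioo (-b) b :=
      ⟨by linarith [hm.1], by linarith [hm.2]⟩
    have hf0 := (hf.pos _ hm').ne'
    have hφ0 := (h.map_pos hr).ne'
    rw [meanCurv_revSurface (h.hasDerivAt_profS hr) (h.hasDerivAt_profY hr) hc.ne'
      (h.profV_pos hr (w 0)).ne' (hf.differentiableAt hm').hasDerivAt hf0, profV, one_div_div,
      (hf.hasDerivAt_phiFun hm').deriv, h.map_profS hr]
    field_simp
    ring

/-! ### The boundary as a smoothly embedded torus. -/

lemma contMDiff_circle_coe :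
    ContMDiff (𝓡 1) 𝓘(ℝ, ℂ) ∞ (fun z : Circle => (z : ℂ)) := by
  have : Fact (Module.finrank ℝ ℂ = 1 + 1) := finrank_real_complex_fact'
  exact contMDiff_coe_sphere (E := ℂ)

/-- A smooth `2π`-periodic function descends to a smooth function on the circle. -/
lemma contMDiff_comp_arg {g : ℝ → ℝ} (hg : ContDiff ℝ ∞ g)
    (hper : ∀ α β, Circle.exp α = Circle.exp β → g α = g β) :
    ContMDiff (𝓡 1) 𝓘(ℝ, ℝ) ∞ (fun z : Circle => g (Complex.arg z)) := by
  intro z₀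
  -- By periodicity the angle may be measured from `z₀`, which moves the branch cut of the logarithm
  -- away from `z₀`.
  have hrew : (fun z : Circle => g (Complex.arg z)) =
      (fun x : ℂ => g ((Complex.log (x * ((z₀⁻¹ : Circle) : ℂ))).im + Complex.arg z₀)) ∘
        fun z : Circle => (z : ℂ) := by
    ext z
    refine hper _ _ ?_
    rw [Complex.log_im, ← Circle.coe_mul, Circle.exp_add, Circle.exp_arg, Circle.exp_arg,
      Circle.exp_arg, inv_mul_cancel_right]
  rw [hrew]
  refine ContMDiffAt.comp z₀ (ContDiffAt.contMDiffAt ?_) (contMDiff_circle_coe z₀)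
  have hz : (z₀ : ℂ) * ((z₀⁻¹ : Circle) : ℂ) ∈ Complex.slitPlane := by
    rw [← Circle.coe_mul, mul_inv_cancel, Circle.coe_one]
    exact Complex.one_mem_slitPlane
  have hlog : ContDiffAt ℝ ∞ (fun x : ℂ => Complex.log (x * ((z₀⁻¹ : Circle) : ℂ))) z₀ :=
    ContDiffAt.restrict_scalars ℝ
      ((Complex.contDiffAt_log hz).comp (z₀ : ℂ) (contDiffAt_id.mul contDiffAt_const))
  exact hg.contDiffAt.comp _ ((Complex.imCLM.contDiff.contDiffAt.comp _ hlog).add contDiffAt_const)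

/-- If `ι ∘ Φ ∘ E` has injective differential at `x` and the source of `Φ` has the same dimension
as that of `E`, then `Φ` has injective differential at `E x`. -/
lemma injective_of_injective_comp {V₁ V₂ V₃ V₄ : Type*}
    [AddCommGroup V₁] [Module ℝ V₁] [AddCommGroup V₂] [Module ℝ V₂] [AddCommGroup V₃] [Module ℝ V₃]
    [AddCommGroup V₄] [Module ℝ V₄] [FiniteDimensional ℝ V₁] [FiniteDimensional ℝ V₂]
    (hdim : Module.finrank ℝ V₁ = Module.finrank ℝ V₂)
    (E : V₁ →ₗ[ℝ] V₂) (Φ : V₂ →ₗ[ℝ] V₃) (ι : V₃ →ₗ[ℝ] V₄)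
    (h : Function.Injective fun x => ι (Φ (E x))) : Function.Injective Φ := by
  have hE : Function.Injective E := fun x y hxy => h (by simp only [hxy])
  have hE' := (LinearMap.injective_iff_surjective_of_finrank_eq_finrank hdim).1 hE
  intro x y hxy
  obtain ⟨x', rfl⟩ := hE' x
  obtain ⟨y', rfl⟩ := hE' y
  exact congrArg E (h (by simp only [hxy]))

namespace IsOddIncreasing

variable {φ : ℝ → ℝ} {a r : ℝ}

/-- The torus obtained by rotating the profile curve. -/
noncomputable def torusMap (φ : ℝ → ℝ) (a r : ℝ) (z : Circle × Circle) : Tube :=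
  (profS φ a r (Complex.arg z.1), z.2, profY φ a r (Complex.arg z.1))

lemma contMDiff_torusMap (h : IsOddIncreasing φ a) (hr : r ∈ Ioo 0 a) :
    ContMDiff ((𝓡 1).prod (𝓡 1)) (𝓘(ℝ, ℝ).prod ((𝓡 1).prod 𝓘(ℝ, ℝ))) ∞ (torusMap φ a r) := by
  have h1 := contMDiff_comp_arg (h.contDiff_profS hr) fun _ _ he => profS_congr_exp he
  have h2 := contMDiff_comp_arg (h.contDiff_profY hr) fun _ _ he => h.profY_congr hr he
  exact (h1.comp contMDiff_fst).prodMk (contMDiff_snd.prodMk (h2.comp contMDiff_fst))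

lemma injective_fderiv_lift (h : IsOddIncreasing φ a) (hr : r ∈ Ioo 0 a) (x : ℝ × ℝ) :
    Function.Injective (fderiv ℝ (fun p : ℝ × ℝ =>
      (profS φ a r p.1, (Circle.exp p.2 : ℂ), profY φ a r p.1)) x) := by
  have hS := (h.hasDerivAt_profS hr x.1).comp_hasFDerivAt x
    (hasFDerivAt_fst (𝕜 := ℝ) (E := ℝ) (F := ℝ))
  have hY := (h.hasDerivAt_profY hr x.1).comp_hasFDerivAt x
    (hasFDerivAt_fst (𝕜 := ℝ) (E := ℝ) (F := ℝ))
  have hexp : HasDerivAt (fun t : ℝ => (Circle.exp t : ℂ))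
      (Complex.exp (x.2 * Complex.I) * Complex.I) x.2 := by
    simp only [Circle.coe_exp]
    have h1 : HasDerivAt (fun z : ℂ => Complex.exp (z * Complex.I))
        (Complex.exp (x.2 * Complex.I) * Complex.I) (x.2 : ℂ) := by
      simpa using ((hasDerivAt_id (x.2 : ℂ)).mul_const Complex.I).cexp
    exact h1.comp_ofReal
  have hE := hexp.hasFDerivAt.comp x (hasFDerivAt_snd (𝕜 := ℝ) (E := ℝ) (F := ℝ))
  have hd := hS.prodMk (hE.prodMk hY)
  have hd' : fderiv ℝ (fun p : ℝ × ℝ =>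
      (profS φ a r p.1, (Circle.exp p.2 : ℂ), profY φ a r p.1)) x = _ := hd.fderiv
  rw [hd', injective_iff_map_eq_zero]
  intro p hp
  simp only [ContinuousLinearMap.prod_apply, Prod.mk_eq_zero] at hp
  obtain ⟨e1, e2, e3⟩ := hp
  have hv := (h.profV_pos hr x.1).ne'
  simp at e1 e2 e3
  have hp1 : p.1 = 0 := by
    by_contra hne
    have hc : Real.cos x.1 = 0 := by tauto
    have hs : Real.sin x.1 = 0 := by tauto
    have := Real.sin_sq_add_cos_sq x.1
    rw [hc, hs] at this
    norm_num at this
  exact Prod.ext hp1 e2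

/-- Precomposing with the covering `ℝ² → S¹ × S¹` and including the target circle in `ℂ` turns the
claim into one about an ordinary derivative between vector spaces. -/
lemma injective_mfderiv_torusMap (h : IsOddIncreasing φ a) (hr : r ∈ Ioo 0 a)
    (z : Circle × Circle) :
    Function.Injective (mfderiv ((𝓡 1).prod (𝓡 1)) (𝓘(ℝ, ℝ).prod ((𝓡 1).prod 𝓘(ℝ, ℝ)))
      (torusMap φ a r) z) := by
  let E : ℝ × ℝ → Circle × Circle := fun x => (Circle.exp x.1, Circle.exp x.2)
  let ι : Tube → ℝ × ℂ × ℝ := fun q => (q.1, (q.2.1 : ℂ), q.2.2)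
  obtain ⟨x, rfl⟩ : ∃ x, E x = z :=
    ⟨(Complex.arg z.1, Complex.arg z.2), Prod.ext (Circle.exp_arg _) (Circle.exp_arg _)⟩
  have hE : MDifferentiableAt 𝓘(ℝ, ℝ × ℝ) ((𝓡 1).prod (𝓡 1)) E x := by
    have h1 : ContMDiff 𝓘(ℝ, ℝ × ℝ) (𝓡 1) ∞ fun x : ℝ × ℝ => Circle.exp x.1 :=
      contMDiff_circleExp.comp contDiff_fst.contMDiff
    have h2 : ContMDiff 𝓘(ℝ, ℝ × ℝ) (𝓡 1) ∞ fun x : ℝ × ℝ => Circle.exp x.2 :=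
      contMDiff_circleExp.comp contDiff_snd.contMDiff
    exact (h1.prodMk h2).mdifferentiable (by simp) x
  have hΦ : MDifferentiableAt ((𝓡 1).prod (𝓡 1)) (𝓘(ℝ, ℝ).prod ((𝓡 1).prod 𝓘(ℝ, ℝ)))
      (torusMap φ a r) (E x) :=
    (h.contMDiff_torusMap hr).mdifferentiable (by simp) _
  have hι : MDifferentiableAt (𝓘(ℝ, ℝ).prod ((𝓡 1).prod 𝓘(ℝ, ℝ))) 𝓘(ℝ, ℝ × ℂ × ℝ) ι
      (torusMap φ a r (E x)) := by
    have h1 : ContMDiff (𝓘(ℝ, ℝ).prod ((𝓡 1).prod 𝓘(ℝ, ℝ))) 𝓘(ℝ, ℂ) ∞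
        fun q : Tube => (q.2.1 : ℂ) := contMDiff_circle_coe.comp (contMDiff_fst.comp contMDiff_snd)
    have h2 : ContMDiff (𝓘(ℝ, ℝ).prod ((𝓡 1).prod 𝓘(ℝ, ℝ))) 𝓘(ℝ, ℝ) ∞
        fun q : Tube => q.2.2 := contMDiff_snd.comp contMDiff_snd
    exact (contMDiff_fst.prodMk_space (h1.prodMk_space h2)).mdifferentiable (by simp) _
  have hcomp : ι ∘ torusMap φ a r ∘ E = fun p : ℝ × ℝ =>
      (profS φ a r p.1, (Circle.exp p.2 : ℂ), profY φ a r p.1) := by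
    ext1 p
    have he := Circle.exp_arg (Circle.exp p.1)
    simp only [Function.comp_apply, ι, E, torusMap, profS_congr_exp he, h.profY_congr hr he]
  have hder := mfderiv_comp x (hι : MDifferentiableAt _ _ ι ((torusMap φ a r ∘ E) x))
    (hΦ.comp x hE)
  rw [mfderiv_comp x hΦ hE, hcomp, mfderiv_eq_fderiv] at hder
  have hinj := h.injective_fderiv_lift hr x
  -- Stated on the model spaces, to which the tangent spaces unfold, so that the dimensions are
  -- visible.
  have key : ∀ (A : ℝ × ℝ →L[ℝ] EuclideanSpace ℝ (Fin 1) × EuclideanSpace ℝ (Fin 1))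
      (B : EuclideanSpace ℝ (Fin 1) × EuclideanSpace ℝ (Fin 1) →L[ℝ]
        ℝ × EuclideanSpace ℝ (Fin 1) × ℝ)
      (C : ℝ × EuclideanSpace ℝ (Fin 1) × ℝ →L[ℝ] ℝ × ℂ × ℝ),
      Function.Injective (fun x => C (B (A x))) → Function.Injective B :=
    fun A B C hABC => injective_of_injective_comp (by simp) A.toLinearMap B.toLinearMap
      C.toLinearMap hABC
  rw [hder] at hinj
  exact key (mfderiv 𝓘(ℝ, ℝ × ℝ) ((𝓡 1).prod (𝓡 1)) E x)
    (mfderiv ((𝓡 1).prod (𝓡 1)) (𝓘(ℝ, ℝ).prod ((𝓡 1).prod 𝓘(ℝ, ℝ))) (torusMap φ a r) (E x))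
    (mfderiv (𝓘(ℝ, ℝ).prod ((𝓡 1).prod 𝓘(ℝ, ℝ))) 𝓘(ℝ, ℝ × ℂ × ℝ) ι (torusMap φ a r (E x))) hinj

lemma isEmbeddedTorus (h : IsOddIncreasing φ a) (hr : r ∈ Ioo 0 a) :
    IsEmbeddedTorus (frontier (symRegion (height φ a r))) := by
  refine ⟨torusMap φ a r, h.contMDiff_torusMap hr, h.injective_mfderiv_torusMap hr, ?_, ?_⟩
  · refine ((h.contMDiff_torusMap hr).continuous.isClosedEmbedding ?_).isEmbedding
    rintro ⟨z, w⟩ ⟨z', w'⟩ he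
    simp only [torusMap, Prod.mk.injEq] at he
    exact Prod.ext ((h.isEmbedding_profCircle hr).injective (Prod.ext he.1 he.2.2)) he.2.1
  · ext ⟨s, w, y⟩
    rw [h.mem_frontier_iff hr]
    constructor
    · rintro ⟨⟨z, w'⟩, he⟩
      simp only [torusMap, Prod.mk.injEq] at he
      exact ⟨_, he.1, he.2.2⟩
    · rintro ⟨α, hS, hY⟩
      refine ⟨(Circle.exp α, w), ?_⟩
      have he := Circle.exp_arg (Circle.exp α)
      rw [torusMap, profS_congr_exp he, h.profY_congr hr he]
      exact Prod.ext hS (Prod.ext rfl hY)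

end IsOddIncreasing

/-! ### Finiteness and divergence of the volume. -/

lemma sqrt_det_tubeMetric {c : ℝ} {f : ℝ → ℝ} {p : Coord 3} (hc : 0 < c) (hf : 0 < f (p 0)) :
    √((tubeMetric c f p).det) = c * f (p 0) := by
  rw [tubeMetric, Matrix.det_diagonal, Fin.prod_univ_three]
  simp only [Matrix.cons_val, one_mul, mul_one]
  rw [← mul_pow, Real.sqrt_sq (mul_pos hc hf).le]

lemma continuous_cover : Continuous cover := by
  unfold cover
  fun_prop

lemma IsBump.measurableSet_fundamental {u : ℝ → ℝ} {r : ℝ} (h : IsBump u r) :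
    MeasurableSet (cover ⁻¹' symRegion u ∩ {p | p 1 ∈ Ico 0 (2 * Real.pi)}) :=
  (h.isOpen_symRegion.preimage continuous_cover).measurableSet.inter
    (measurableSet_Ico.preimage (measurable_pi_apply 1))

/-- The fundamental piece lies in a compact box over `[-r, r]`, where the density `c f` is bounded
because `r < b`. -/
lemma IsWarping.riemVolume_lt_top {f u : ℝ → ℝ} {b c r : ℝ} (hf : IsWarping f b) (hc : 0 < c)
    (hu : IsBump u r) (hr : r < b) : riemVolume (tubeMetric c f) (symRegion u) < ⊤ := by
  have hsub : Icc (-r) r ⊆ Ioo (-b) b := fun x hx => ⟨by linarith [hx.1], by linarith [hx.2]⟩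
  obtain ⟨M, hM⟩ := isCompact_Icc.exists_bound_of_continuousOn (hf.smooth.continuousOn.mono hsub)
  obtain ⟨B, hB⟩ := (isCompact_Icc (a := -r) (b := r)).exists_bound_of_continuousOn
    hu.continuous.continuousOn
  set A := cover ⁻¹' symRegion u ∩ {p | p 1 ∈ Ico 0 (2 * Real.pi)} with hA
  have hle : ∀ p ∈ A, ENNReal.ofReal √((tubeMetric c f p).det) ≤ ENNReal.ofReal (c * M) := by
    intro p hp
    have hp0 := Ioo_subset_Icc_self (hu.mem_Ioo hp.1)
    change p 0 ∈ Icc (-r) r at hp0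
    rw [sqrt_det_tubeMetric hc (hf.pos _ (hsub hp0))]
    exact ENNReal.ofReal_le_ofReal
      (mul_le_mul_of_nonneg_left ((le_abs_self _).trans (hM _ hp0)) hc.le)
  have hbox : A ⊆ Icc ![-r, 0, -B] ![r, 2 * Real.pi, B] := by
    intro p hp
    have hp0 := Ioo_subset_Icc_self (hu.mem_Ioo hp.1)
    change p 0 ∈ Icc (-r) r at hp0
    have hp2 : |p 2| ≤ B := (show |p 2| < u (p 0) from hp.1).le.trans
      ((le_abs_self _).trans (hB _ hp0))
    rw [abs_le] at hp2
    constructor <;> intro i <;> fin_cases i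
    exacts [hp0.1, hp.2.1, hp2.1, hp0.2, hp.2.2.le, hp2.2]
  calc riemVolume (tubeMetric c f) (symRegion u)
      ≤ ∫⁻ _ in A, ENNReal.ofReal (c * M) :=
        MeasureTheory.setLIntegral_mono' hu.measurableSet_fundamental hle
    _ = ENNReal.ofReal (c * M) * MeasureTheory.volume A := MeasureTheory.setLIntegral_const _ _
    _ < ⊤ := ENNReal.mul_lt_top ENNReal.ofReal_lt_top
        ((MeasureTheory.measure_mono hbox).trans_lt isCompact_Icc.measure_lt_top)

/-- The volume of the region `|y| < u(s)` is bounded below by that of a box that it contains. -/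
lemma IsWarping.le_riemVolume {f u : ℝ → ℝ} {b c r x₀ x₁ m L : ℝ} (hf : IsWarping f b) (hc : 0 < c)
    (hu : IsBump u r) (hr : r < b) (hL : ∀ x ∈ Ioo x₀ x₁, L ≤ u x)
    (hx : x₀ ≤ x₁) (hm0 : 0 ≤ m) (hm : ∀ x ∈ Ioo x₀ x₁, m ≤ f x) :
    ENNReal.ofReal (c * m * (x₁ - x₀) * (2 * Real.pi) * (2 * L)) ≤
      riemVolume (tubeMetric c f) (symRegion u) := by
  have hpi := Real.pi_pos
  set A := cover ⁻¹' symRegion u ∩ {p | p 1 ∈ Ico 0 (2 * Real.pi)} with hA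
  set D : Set (Coord 3) := univ.pi fun i => Ioo (![x₀, 0, -L] i) (![x₁, 2 * Real.pi, L] i) with hD
  have hDA : D ⊆ A := by
    intro p hp
    have h0 : p 0 ∈ Ioo x₀ x₁ := hp 0 (mem_univ _)
    have h1 : p 1 ∈ Ioo 0 (2 * Real.pi) := hp 1 (mem_univ _)
    have h2 : p 2 ∈ Ioo (-L) L := hp 2 (mem_univ _)
    exact ⟨show |p 2| < u (p 0) from (abs_lt.2 h2).trans_le (hL _ h0), Ioo_subset_Ico_self h1⟩
  have hvol : MeasureTheory.volume D = ENNReal.ofReal (x₁ - x₀) * ENNReal.ofReal (2 * Real.pi) *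
      ENNReal.ofReal (2 * L) := by
    rw [hD, Real.volume_pi_Ioo, Fin.prod_univ_three]
    simp [two_mul]
  have hDm : MeasurableSet D := MeasurableSet.univ_pi fun _ => measurableSet_Ioo
  calc ENNReal.ofReal (c * m * (x₁ - x₀) * (2 * Real.pi) * (2 * L))
      = ENNReal.ofReal (c * m) * MeasureTheory.volume D := by
        have e1 : 0 ≤ c * m := mul_nonneg hc.le hm0
        have e2 : 0 ≤ x₁ - x₀ := by linarith
        -- Only the left factor of each product must be nonnegative; with `2 * L` last, the sign of
        -- `L` is not needed.
        rw [hvol, ENNReal.ofReal_mul (by positivity), ENNReal.ofReal_mul (by positivity),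
          ENNReal.ofReal_mul e1]
        simp only [mul_assoc]
    _ = ∫⁻ _ in D, ENNReal.ofReal (c * m) := (MeasureTheory.setLIntegral_const _ _).symm
    _ ≤ ∫⁻ p in D, ENNReal.ofReal √((tubeMetric c f p).det) := by
        refine MeasureTheory.setLIntegral_mono' hDm fun p hp => ?_
        have h0 : p 0 ∈ Ioo x₀ x₁ := hp 0 (mem_univ _)
        have hp0 := hu.mem_Ioo (hDA hp).1
        change p 0 ∈ Ioo (-r) r at hp0
        rw [sqrt_det_tubeMetric hc (hf.pos _ ⟨by linarith [hp0.1], by linarith [hp0.2]⟩)]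
        exact ENNReal.ofReal_le_ofReal (mul_le_mul_of_nonneg_left (hm _ h0) hc.le)
    _ ≤ riemVolume (tubeMetric c f) (symRegion u) := MeasureTheory.lintegral_mono_set hDA

namespace IsWarping

variable {f : ℝ → ℝ} {b a : ℝ}

lemma phiFun_strictMonoOn (hf : IsWarping f b) (hab : a < b)
    (h : IsOddIncreasing (phiFun f) a) : StrictMonoOn (phiFun f) (Icc 0 a) := by
  refine strictMonoOn_of_deriv_pos (convex_Icc _ _)
    (hf.contDiffOn_phiFun.continuousOn.mono fun x hx => ?_) fun x hx => ?_
  · exact ⟨by linarith [hx.1, hf.pos_radius], by linarith [hx.2]⟩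
  · rw [interior_Icc] at hx
    exact h.deriv_pos x ⟨by linarith [hx.1, hx.2], hx.2⟩

/-- Logarithmic lower bound for the height of the bubbles. -/
lemma exists_log_le_height (hf : IsWarping f b) (ha : 0 < a) (hab : a < b)
    (h : IsOddIncreasing (phiFun f) a) (hcrit : deriv (phiFun f) a = 0) :
    ∃ C > 0, ∀ r ∈ Ioo (a / 2) a, ∀ x ∈ Icc (a / 2) r,
      C * (Real.log (a - x) - Real.log (a - r)) ≤ height (phiFun f) a r x := by
  obtain ⟨K, hK, hquad⟩ := hf.exists_quadratic_bound ha hab hcrit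
  have hmono := hf.phiFun_strictMonoOn hab h
  have hφa : 0 < phiFun f a := hf.phiFun_pos ⟨ha, hab⟩
  have hφm : 0 < phiFun f (a / 2) := hf.phiFun_pos ⟨by linarith, by linarith⟩
  -- Chosen so that `φ(r)² - φ(x)² ≤ (φ(a) + φ(x)) (φ(a) - φ(x)) ≤ (Q (a - x))²`.
  set Q := √(2 * phiFun f a * K) with hQ
  have hQpos : 0 < Q := Real.sqrt_pos.2 (by positivity)
  refine ⟨phiFun f (a / 2) / Q, by positivity, fun r hr x hx => ?_⟩
  have hr' : r ∈ Ioo 0 a := ⟨by linarith [hr.1], hr.2⟩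
  set g : ℝ → ℝ := fun x => height (phiFun f) a r x -
    phiFun f (a / 2) / Q * (Real.log (a - x) - Real.log (a - r)) with hg
  have hder : ∀ x ∈ Ioo (a / 2) r, HasDerivAt g
      (-(phiFun f x / √(phiFun f r ^ 2 - phiFun f x ^ 2)) -
        phiFun f (a / 2) / Q * (-1 / (a - x))) x := by
    intro x hx
    have hax : a - x ≠ 0 := by linarith [hx.2, hr.2]
    exact (h.hasDerivAt_height hr' ⟨by linarith [hx.1, hr'.1], hx.2⟩).sub
      (((((hasDerivAt_id x).const_sub a).log hax).sub_const _).const_mul _)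
  have hanti : AntitoneOn g (Icc (a / 2) r) := by
    refine antitoneOn_of_deriv_nonpos (convex_Icc _ _) ?_ ?_ ?_
    · refine (h.continuous_height hr').continuousOn.sub (continuousOn_const.mul
        (ContinuousOn.sub (ContinuousOn.log (by fun_prop) fun y hy => ?_) continuousOn_const))
      linarith [hy.2, hr.2]
    · rw [interior_Icc]
      exact fun y hy => (hder y hy).differentiableAt.differentiableWithinAt
    · rw [interior_Icc]
      intro y hy
      rw [(hder y hy).deriv]
      have hay : 0 < a - y := by linarith [hy.2, hr.2]
      have hyI : y ∈ Icc 0 a := ⟨by linarith [hy.1], by linarith⟩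
      have h1 : phiFun f (a / 2) ≤ phiFun f y :=
        (hmono ⟨by linarith, by linarith⟩ hyI hy.1).le
      have h2 : phiFun f y < phiFun f r := hmono hyI ⟨hr'.1.le, hr.2.le⟩ hy.2
      have h3 : phiFun f r < phiFun f a := hmono ⟨hr'.1.le, hr.2.le⟩ ⟨ha.le, le_rfl⟩ hr.2
      have hpos : 0 < √(phiFun f r ^ 2 - phiFun f y ^ 2) := Real.sqrt_pos.2 (by nlinarith)
      have hle : √(phiFun f r ^ 2 - phiFun f y ^ 2) ≤ Q * (a - y) := by
        rw [Real.sqrt_le_left (by positivity), mul_pow, hQ, Real.sq_sqrt (by positivity)]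
        have h4 := hquad y ⟨by linarith [hy.1], by linarith⟩
        have h5 : phiFun f a ^ 2 - phiFun f y ^ 2 ≤ 2 * phiFun f a * (K * (a - y) ^ 2) := by
          nlinarith
        nlinarith
      have hfrac : phiFun f (a / 2) / (Q * (a - y)) ≤
          phiFun f y / √(phiFun f r ^ 2 - phiFun f y ^ 2) := by
        have h4 := hφm.le.trans h1
        gcongr
      have he : phiFun f (a / 2) / Q * (-1 / (a - y)) = -(phiFun f (a / 2) / (Q * (a - y))) := by
        field_simp
      rw [he]
      linarith
  -- At `x = r` both the height and the logarithmic term vanish, so `g ≥ g(r) = 0`.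
  have hfin := hanti hx (right_mem_Icc.2 hr.1.le) hx.2
  simp only [hg, sub_self, mul_zero, h.height_of_notMem hr' (x := r) (fun hcon => lt_irrefl _ hcon.2)]
    at hfin
  linarith

/-- On the fixed window `(a/2, 3a/4)` the density is bounded below, and `a - x ≥ a/4` makes the
logarithmic bound uniform in `x`; boxes of unbounded height fit inside. -/
lemma tendsto_riemVolume (hf : IsWarping f b) {c : ℝ} (hc : 0 < c) (ha : 0 < a) (hab : a < b)
    (h : IsOddIncreasing (phiFun f) a) (hcrit : deriv (phiFun f) a = 0) :
    Tendsto (fun r => riemVolume (tubeMetric c f) (symRegion (height (phiFun f) a r)))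
      (𝓝[<] a) (𝓝 ⊤) := by
  obtain ⟨C, hC, hlog⟩ := hf.exists_log_le_height ha hab h hcrit
  have hsub : Icc (a / 2) (3 * a / 4) ⊆ Ioo (-b) b := fun x hx =>
    ⟨by linarith [hx.1], by linarith [hx.2]⟩
  obtain ⟨xm, hxm, hmin⟩ := isCompact_Icc.exists_isMinOn
    (nonempty_Icc.2 (by linarith : a / 2 ≤ 3 * a / 4)) (hf.smooth.continuousOn.mono hsub)
  have hm := hf.pos xm (hsub hxm)
  set L : ℝ → ℝ := fun r => C * (Real.log (a / 4) - Real.log (a - r)) with hLdef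
  have hL : Tendsto L (𝓝[<] a) atTop := by
    have h1 : Tendsto (fun r => a - r) (𝓝[<] a) (𝓝[>] 0) := by
      refine tendsto_nhdsWithin_iff.2 ⟨?_, ?_⟩
      · have : Tendsto (fun r => a - r) (𝓝 a) (𝓝 (a - a)) := tendsto_const_nhds.sub tendsto_id
        rw [sub_self] at this
        exact this.mono_left nhdsWithin_le_nhds
      · filter_upwards [self_mem_nhdsWithin] with r hr
        exact sub_pos.2 (show r < a from hr)
    refine Tendsto.const_mul_atTop hC ?_
    simp only [sub_eq_add_neg (Real.log (a / 4))]
    exact tendsto_atTop_add_const_left _ _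
      (tendsto_neg_atBot_atTop.comp (Real.tendsto_log_nhdsGT_zero.comp h1))
  have hlow : Tendsto (fun r => ENNReal.ofReal
      (c * f xm * (3 * a / 4 - a / 2) * (2 * Real.pi) * (2 * L r))) (𝓝[<] a) (𝓝 ⊤) := by
    refine ENNReal.tendsto_ofReal_atTop.comp (Tendsto.const_mul_atTop ?_
      (Tendsto.const_mul_atTop two_pos hL))
    have : 0 < 3 * a / 4 - a / 2 := by linarith
    have := Real.pi_pos
    positivity
  refine tendsto_nhds_top_mono hlow ?_
  filter_upwards [Ioo_mem_nhdsLT (by linarith : 3 * a / 4 < a)] with r hr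
  have hr' : r ∈ Ioo 0 a := ⟨by linarith [hr.1], hr.2⟩
  refine hf.le_riemVolume hc (h.isBump hr') (hr.2.trans hab) (fun x hx => ?_) (by linarith) hm.le
    fun x hx => hmin (Ioo_subset_Icc_self hx)
  refine le_trans ?_ (hlog r ⟨by linarith [hr.1], hr.2⟩ x ⟨hx.1.le, by linarith [hx.2, hr.1]⟩)
  refine mul_le_mul_of_nonneg_left (sub_le_sub_right (Real.log_le_log (by linarith) ?_) _) hC.le
  linarith [hx.2]

end IsWarping

/-! ### Reduction to a symmetric open interval, and conclusion. -/

lemma isWarping_of_ordConnected {I : Set ℝ} (hI : I.OrdConnected) (hIsymm : ∀ s ∈ I, -s ∈ I)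
    {f : ℝ → ℝ} (hf_smooth : ContDiffOn ℝ ∞ f I) (hf_pos : ∀ s ∈ I, 0 < f s)
    (hf_even : ∀ s ∈ I, f (-s) = f s) {s₀ δ : ℝ} (hs₀ : 0 < s₀) (hδ : 0 < δ)
    (hsub : Ioo s₀ (s₀ + δ) ⊆ I) : Ioo (-(s₀ + δ)) (s₀ + δ) ⊆ I ∧ IsWarping f (s₀ + δ) := by
  have hIoo : Ioo (-(s₀ + δ)) (s₀ + δ) ⊆ I := by
    intro x hx
    -- A point `t` of `(s₀, s₀ + δ)` beyond `|x|` lies in `I`, as does `-t`, and `x` is between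
    -- them.
    obtain ⟨t, ht1, ht2⟩ := exists_between
      (max_lt (by linarith : s₀ < s₀ + δ) (abs_lt.2 hx))
    have ht : t ∈ I := hsub ⟨(le_max_left _ _).trans_lt ht1, ht2⟩
    exact hI.out (hIsymm t ht) ht (abs_le.1 ((le_max_right _ _).trans ht1.le))
  exact ⟨hIoo, by linarith, hf_smooth.mono hIoo, fun s hs => hf_pos s (hIoo hs),
    fun s hs => hf_even s (hIoo hs)⟩

theorem theorem9p1
    (I : Set ℝ) (hI : I.OrdConnected) (hIsymm : ∀ s ∈ I, -s ∈ I)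
    (f : ℝ → ℝ) (hf_smooth : ContDiffOn ℝ ∞ f I) (hf_pos : ∀ s ∈ I, 0 < f s)
    (hf_even : ∀ s ∈ I, f (-s) = f s)
    (c : ℝ) (hc : 0 < c)
    (s₀ : ℝ) (hs₀ : 0 < s₀)
    (hneg : ∀ s ∈ Ioo 0 s₀, deriv (deriv fun x => Real.log (primF f x)) s < 0)
    (hpos : ∃ δ > 0, Ioo s₀ (s₀ + δ) ⊆ I ∧
      ∀ s ∈ Ioo s₀ (s₀ + δ), 0 < deriv (deriv fun x => Real.log (primF f x)) s) :
    ∃ S Ω : ℝ → Set Tube,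
      (∀ s₁ ∈ Ioo 0 s₀,
        IsSoapBubble I (tubeMetric c f) (S s₁) (Ω s₁) (1 / phiFun f s₁) ∧
        IsEmbeddedTorus (S s₁) ∧
        S s₁ ⊆ tubeOver (Ioo (-s₀) s₀) ∧
        riemVolume (tubeMetric c f) (Ω s₁) < ⊤) ∧
      Tendsto (fun s₁ => riemVolume (tubeMetric c f) (Ω s₁)) (𝓝[<] s₀) (𝓝 ⊤) := by

  obtain ⟨δ, hδ, hδI, hδpos⟩ := hpos
  obtain ⟨hIoo, hf⟩ := isWarping_of_ordConnected hI hIsymm hf_smooth hf_pos hf_even hs₀ hδ hδI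
  have hlt : s₀ < s₀ + δ := by linarith
  have h := hf.isOddIncreasing hlt hneg
  refine ⟨fun r => frontier (symRegion (height (phiFun f) s₀ r)),
    fun r => symRegion (height (phiFun f) s₀ r), fun r hr => ⟨?_, ?_, ?_, ?_⟩, ?_⟩
  · have hb := h.isBump hr
    refine ⟨hb.isOpen_symRegion, hb.isConnected_symRegion, hb.isCompact_closure, ?_,
      hb.interior_closure, rfl, hf.hasConstMeanCurv hlt h hr hc⟩
    rw [hb.closure_symRegion]
    intro q hq
    have hq1 := IsOddIncreasing.Icc_subset hr hq.1
    exact hIoo ⟨by linarith [hq1.1], by linarith [hq1.2]⟩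
  · exact h.isEmbeddedTorus hr
  · intro q hq
    obtain ⟨α, hα, -⟩ := (h.mem_frontier_iff hr).1 hq
    exact IsOddIncreasing.Icc_subset hr (hα ▸ h.profS_mem hr α)
  · exact hf.riemVolume_lt_top hc (h.isBump hr) (hr.2.trans hlt)
  · exact hf.tendsto_riemVolume hc hs₀ hlt h (hf.deriv_phiFun_eq_zero hs₀ hlt hneg hδpos)
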